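/- Let $p$ be a prime and let $F$ be a finite extension of $\mathbb{Q}_p$ with ring of integers $\mathcal{O}_F$, uniformizer $\varpi$ and residue field $k_F$ with $q=p^f$ elements. For $\lambda\in k_F$ let $[\lambda]\in\mathcal{O}_F$ be its Teichmüller representative. Let $E$ be a finite extension of $\mathbb{Q}_p$ with ring of integers $\mathcal{O}_E$ and uniformizer $\varpi_E$, such that the set $S$ of $\mathbb{Q}_p$-algebra embeddings $F\to E$ has $[F:\mathbb{Q}_p]$ elements, and fix $\iota\in S$. Let $G=\mathrm{GL}_2(F)$, $K=\mathrm{GL}_2(\mathcal{O}_F)$, let $Z$ be the centre of $G$, and let $\alpha=\begin{pmatrix}1&0\\0&\varpi\end{pmatrix}$. Let $v$ be the valuation of $F$ with $v(\varpi)=1$. Let $\vec d=(d_\sigma)_{\sigma\in S}$ be a family of non-negative integers; for each $\sigma$ with $d_\sigma$ odd, suppose that a square root of $\sigma(\varpi)$ in $E$ has been chosen. Let $\rho_{\vec d}$ be the representation of $G$ on $\bigotimes_{\sigma\in S}\bigoplus_{i=0}^{d_\sigma}E\,x_\sigma^{d_\sigma-i}y_\sigma^{i}$ (tensor product over $E$)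 in which $g=\begin{pmatrix}a&b\\c&d\end{pmatrix}$ acts on the factor of index $\sigma$ by the substitution $x_\sigma\mapsto\sigma(a)x_\sigma+\sigma(c)y_\sigma$, $y_\sigma\mapsto\sigma(b)x_\sigma+\sigma(d)y_\sigma$, multiplied by $\sigma(\varpi)^{-v(\det g)d_\sigma/2}$. Let $\rho^0_{\vec d}$ be the $\mathcal{O}_E$-lattice spanned by the vectors $\bigotimes_\sigma x_\sigma^{d_\sigma-i_\sigma}y_\sigma^{i_\sigma}$, $0\le i_\sigma\le d_\sigma$. Let $\mathrm{ind}\,\rho_{\vec d}$ be the space of functions $h:G\to\rho_{\vec d}$, with support compact modulo $Z$ (equivalently, contained in a finite union of cosets $KZg$), such that $h(\kappa g)=\rho_{\vec d}(\kappa)h(g)$ for $\kappa\in KZ$, $g\in G$. The group $G$ acts on it by right translations. Let $\mathrm{ind}\,\rho^0_{\vec d}$ be the $\mathcal{O}_E$-submodule of the functions with values in $\rho^0_{\vec d}$. Let $\psi:G\to\mathrm{End}_E(\rho_{\vec d})$ be the function supported in $KZ\alpha^{-1}KZ$ such that $\psi(\kappa_1\alpha^{-1}\kappa_2)=\rho_{\vec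 d}(\kappa_1)\circ U_{\vec d}\circ\rho_{\vec d}(\kappa_2)$ for $\kappa_1,\kappa_2\in KZ$, where $U_{\vec d}$ multiplies $\bigotimes_\sigma x_\sigma^{d_\sigma-i_\sigma}y_\sigma^{i_\sigma}$ by $\prod_\sigma\sigma(\varpi)^{d_\sigma-i_\sigma}$, and let $T$ be the $G$-equivariant endomorphism $(Th)(g)=\sum_{xKZ\in G/KZ}\psi(x)\bigl(h(x^{-1}g)\bigr)$ of $\mathrm{ind}\,\rho_{\vec d}$. For $a_p\in\mathcal{O}_E$ put $$\Pi_{\vec d,a_p}=\frac{\mathrm{ind}\,\rho_{\vec d}}{(T-a_p)(\mathrm{ind}\,\rho_{\vec d})},\qquad \Theta_{\vec d,a_p}=\mathrm{Image}\bigl(\mathrm{ind}\,\rho^0_{\vec d}\to\Pi_{\vec d,a_p}\bigr).$$ For $0\le l\le f-1$ let $J_l$ be the set of $\sigma\in S$ such that $d_\sigma\ne0$ and $\sigma([\lambda])=\iota([\lambda])^{p^l}$ for all $\lambda\in k_F$; the index $l$ is read modulo $f$. For $\sigma\in J_l$ let $v_\sigma$ be the least integer $i$ with $1\le i\le f$ and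 $J_{l+i}\ne\emptyset$. Assume that (i) $|J_l|\le1$ for every $l\in\{0,\dots,f-1\}$; (ii) $d_\sigma+1\le p^{v_\sigma}$ for every $l\in\{0,\dots,f-1\}$ and every $\sigma\in J_l$. Then for every $a_p\in\mathcal{O}_E$ the $\mathcal{O}_E$-submodule $\Theta_{\vec d,a_p}$ of $\Pi_{\vec d,a_p}$ is stable under $G$, is a lattice (every vector of $\Pi_{\vec d,a_p}$ has a nonzero $E$-multiple in it), and is separated: $\bigcap_{n\ge0}\varpi_E^n\Theta_{\vec d,a_p}=0$; in particular it contains no $E$-line. -/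

import Mathlib

open scoped TensorProduct Pointwise

namespace BreuilLattice

noncomputable section

/-! ### Local fields -/

/-- The ring of integers `{x | ‖x‖ ≤ 1}` of a nonarchimedean normed field. -/
abbrev integers (L : Type*) [NormedField L] [IsUltrametricDist L] : ValuationSubring L :=
  (NormedField.valuation (K := L)).valuationSubring

theorem mem_integers {L : Type*} [NormedField L] [IsUltrametricDist L] {x : L} :
    x ∈ integers L ↔ ‖x‖ ≤ 1 := by
  rw [Valuation.mem_valuationSubring_iff]
  simp [← NNReal.coe_le_coe]

/-- `ϖ` is a uniformizer: a nonzero generator of the maximal ideal of the ring of integers. -/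
def IsUniformizer {L : Type*} [NormedField L] [IsUltrametricDist L] (ϖ : integers L) : Prop :=
  ϖ ≠ 0 ∧ IsLocalRing.maximalIdeal (integers L) = Ideal.span {ϖ}

/-- The set of Teichmüller representatives of the residue field with `q` elements,
that is, the set of the roots of `X ^ q - X`. -/
def teichmullerSet (L : Type*) [Field L] (q : ℕ) : Set L := {x | x ^ q = x}

section Valuation

variable {L : Type*} [NormedField L] [IsUltrametricDist L]

theorem mem_maximalIdeal_iff {x : integers L} :
    x ∈ IsLocalRing.maximalIdeal (integers L) ↔ ‖(x : L)‖ < 1 := by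
  rw [IsLocalRing.mem_maximalIdeal, mem_nonunits_iff, ← not_le, not_iff_not]
  constructor
  · rintro ⟨u, rfl⟩
    have h1 : ‖((u⁻¹ : (integers L)ˣ) : L)‖ ≤ 1 := mem_integers.1 (u⁻¹ : (integers L)ˣ).1.2
    have h2 : ((u : integers L) : L) * ((u⁻¹ : (integers L)ˣ) : integers L) = 1 := by
      exact_mod_cast congrArg (Subtype.val) (Units.mul_inv u)
    have h3 := congrArg norm h2
    rw [norm_mul, norm_one] at h3
    nlinarith [norm_nonneg ((u : integers L) : L)]
  · intro h
    have hx0 : (x : L) ≠ 0 := by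
      intro h0
      rw [h0, norm_zero] at h
      linarith
    have hinv : (x : L)⁻¹ ∈ integers L := by
      rw [mem_integers, norm_inv]
      exact inv_le_one_of_one_le₀ h
    exact IsUnit.of_mul_eq_one ⟨(x : L)⁻¹, hinv⟩ (Subtype.ext (mul_inv_cancel₀ hx0))

namespace IsUniformizer

variable {ϖ : integers L}

theorem coe_ne_zero (h : IsUniformizer ϖ) : (ϖ : L) ≠ 0 := fun h0 => h.1 (Subtype.ext h0)

theorem norm_pos (h : IsUniformizer ϖ) : 0 < ‖(ϖ : L)‖ := _root_.norm_pos_iff.2 h.coe_ne_zero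

theorem norm_lt_one (h : IsUniformizer ϖ) : ‖(ϖ : L)‖ < 1 :=
  mem_maximalIdeal_iff.1 (h.2 ▸ Ideal.mem_span_singleton_self ϖ)

theorem norm_le (h : IsUniformizer ϖ) {x : L} (hx : ‖x‖ < 1) : ‖x‖ ≤ ‖(ϖ : L)‖ := by
  have hx' : (⟨x, mem_integers.2 hx.le⟩ : integers L) ∈ IsLocalRing.maximalIdeal (integers L) :=
    mem_maximalIdeal_iff.2 hx
  rw [h.2, Ideal.mem_span_singleton] at hx'
  obtain ⟨c, hc⟩ := hx'
  have hc' : x = ϖ * c := congrArg Subtype.val hc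
  rw [hc', norm_mul]
  exact mul_le_of_le_one_right (norm_nonneg _) (mem_integers.1 c.2)

theorem exists_zpow (h : IsUniformizer ϖ) {x : L} (hx : x ≠ 0) :
    ∃ n : ℤ, ‖x‖ = ‖(ϖ : L)‖ ^ n := by
  obtain ⟨n, hn1, hn2⟩ := exists_mem_Ioc_zpow (_root_.norm_pos_iff.2 hx)
    ((one_lt_inv₀ h.norm_pos).2 h.norm_lt_one)
  have hp := zpow_pos h.norm_pos (n + 1)
  refine ⟨-(n + 1), le_antisymm (by simpa using hn2) ?_⟩
  by_contra hlt
  rw [not_le, zpow_neg, lt_inv_comm₀ (_root_.norm_pos_iff.2 hx) hp] at hlt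
  have h1 : ‖x * (ϖ : L) ^ (n + 1)‖ < 1 := by
    rw [norm_mul, norm_zpow]
    rwa [lt_inv_comm₀ hp (_root_.norm_pos_iff.2 hx), ← one_div, lt_div_iff₀ hp] at hlt
  have h2 := h.norm_le h1
  rw [norm_mul, norm_zpow, zpow_add_one₀ h.norm_pos.ne', ← mul_assoc] at h2
  have h3 : ‖x‖ * ‖(ϖ : L)‖ ^ n ≤ 1 := by
    by_contra h4
    nlinarith [h.norm_pos]
  rw [inv_zpow] at hn1
  have h5 := zpow_pos h.norm_pos n
  rw [inv_lt_iff_one_lt_mul₀ h5] at hn1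
  linarith

end IsUniformizer

/-- The valuation of `x` normalized by `v(ϖ) = 1`, i.e. the integer `n` with `‖x‖ = ‖ϖ‖ ^ n`
(for `x ≠ 0`). -/
def ord (ϖ : integers L) (x : L) : ℤ :=
  open Classical in if h : ∃ n : ℤ, ‖x‖ = ‖(ϖ : L)‖ ^ n then h.choose else 0

theorem IsUniformizer.norm_eq {ϖ : integers L} (h : IsUniformizer ϖ) {x : L} (hx : x ≠ 0) :
    ‖x‖ = ‖(ϖ : L)‖ ^ ord ϖ x := by
  rw [ord, dif_pos (h.exists_zpow hx)]
  exact (h.exists_zpow hx).choose_spec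

theorem IsUniformizer.ord_eq {ϖ : integers L} (h : IsUniformizer ϖ) {x : L} {n : ℤ}
    (hn : ‖x‖ = ‖(ϖ : L)‖ ^ n) : ord ϖ x = n := by
  have hx : x ≠ 0 := by
    rintro rfl
    rw [norm_zero] at hn
    exact (zpow_pos h.norm_pos n).ne hn
  exact zpow_right_injective₀ h.norm_pos h.norm_lt_one.ne ((h.norm_eq hx).symm.trans hn)

theorem IsUniformizer.ord_mul {ϖ : integers L} (h : IsUniformizer ϖ) {x y : L}
    (hx : x ≠ 0) (hy : y ≠ 0) : ord ϖ (x * y) = ord ϖ x + ord ϖ y :=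
  h.ord_eq (by rw [norm_mul, h.norm_eq hx, h.norm_eq hy, zpow_add₀ h.norm_pos.ne'])

theorem IsUniformizer.ord_one {ϖ : integers L} (h : IsUniformizer ϖ) : ord ϖ (1 : L) = 0 :=
  h.ord_eq (by simp)

end Valuation

/-! ### Compact induction and Hecke operators

`G` is a group, `H` a subgroup and `ρ` a representation of `G`, of which the constructions below
use the restriction to `H` only. They are applied to `G = GL₂(F)` and to the
subgroup `H = KZ`, which is open and compact modulo `Z`: a function on `G` whose support is stable
by left translations by `H` has a support that is compact modulo `Z` if and only if
its support is contained in a finite union of cosets `H a`. -/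

section Induction

variable {R G V : Type*} [CommRing R] [Group G] [AddCommGroup V] [Module R V]

/-- The support of `f` is contained in a finite union of cosets `H a`. -/
def HasFiniteSupportMod {M : Type*} [Zero M] (H : Subgroup G) (f : G → M) : Prop :=
  ∃ A : Finset G, ∀ g, f g ≠ 0 → ∃ a ∈ A, g * a⁻¹ ∈ H

/-- The space `ind ρ` of functions `f : G → V` with finite support modulo `H` such that
`f (κ g) = ρ(κ) (f g)` for `κ ∈ H`. -/
def ind (H : Subgroup G) (ρ : Representation R G V) : Submodule R (G → V) where
  carrier := {f | (∀ κ ∈ H, ∀ g, f (κ * g) = ρ κ (f g)) ∧ HasFiniteSupportMod H f}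
  zero_mem' := ⟨by simp, ∅, by simp⟩
  add_mem' := by
    classical
    rintro f₁ f₂ ⟨h₁, A₁, hA₁⟩ ⟨h₂, A₂, hA₂⟩
    refine ⟨fun κ hκ g => by simp [h₁ κ hκ g, h₂ κ hκ g], A₁ ∪ A₂, fun g hg => ?_⟩
    by_cases h : f₁ g = 0
    · obtain ⟨a, ha, hg'⟩ := hA₂ g (by simpa [h] using hg)
      exact ⟨a, Finset.mem_union_right _ ha, hg'⟩
    · obtain ⟨a, ha, hg'⟩ := hA₁ g h
      exact ⟨a, Finset.mem_union_left _ ha, hg'⟩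
  smul_mem' := by
    rintro c f ⟨h, A, hA⟩
    refine ⟨fun κ hκ g => by simp [h κ hκ g], A, fun g hg => hA g fun h0 => hg (by simp [h0])⟩

/-- The action of `G` on `ind ρ` by right translations: `(g • f) g' = f (g' g)`. -/
def indRep (H : Subgroup G) (ρ : Representation R G V) : Representation R G (ind H ρ) where
  toFun g :=
    { toFun := fun f => ⟨fun g' => f.1 (g' * g), by
        obtain ⟨f, h, A, hA⟩ := f
        classical
        refine ⟨fun κ hκ g' => by simp only [mul_assoc, h κ hκ], A.image (· * g⁻¹), ?_⟩
        intro g' hg'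
        obtain ⟨a, ha, hm⟩ := hA _ hg'
        exact ⟨a * g⁻¹, Finset.mem_image_of_mem _ ha, by simpa [mul_assoc] using hm⟩⟩
      map_add' := fun _ _ => rfl
      map_smul' := fun _ _ => rfl }
  map_one' := by ext f g'; simp
  map_mul' g₁ g₂ := by ext f g'; simp [mul_assoc]

/-- The elements of the Hecke algebra of `H` and `ρ`: functions `φ : G → End V` with finite
support modulo `H` such that `φ (κ₁ g κ₂) = ρ(κ₁) ∘ φ g ∘ ρ(κ₂)` for `κ₁, κ₂ ∈ H`. -/
structure IsHeckeFunction (H : Subgroup G) (ρ : Representation R G V) (φ : G → Module.End R V) :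
    Prop where
  equivariant : ∀ κ₁ ∈ H, ∀ κ₂ ∈ H, ∀ g, φ (κ₁ * g * κ₂) = ρ κ₁ ∘ₗ φ g ∘ₗ ρ κ₂
  finite_support : HasFiniteSupportMod H φ

/-- The function `x H ↦ φ x (f (x⁻¹ g))` on `G ⧸ H`. -/
def heckeTerm {H : Subgroup G} {ρ : Representation R G V} {φ : G → Module.End R V}
    (hφ : IsHeckeFunction H ρ φ) (f : ind H ρ) (g : G) (x : G ⧸ H) : V :=
  Quotient.liftOn' x (fun x => φ x (f.1 (x⁻¹ * g))) (by
    intro x y hxy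
    rw [QuotientGroup.leftRel_apply] at hxy
    have h1 := hφ.equivariant 1 H.one_mem _ hxy x
    have h2 := f.2.1 _ hxy (y⁻¹ * g)
    have h3 : x⁻¹ * y * (y⁻¹ * g) = x⁻¹ * g := by group
    have h4 : 1 * x * (x⁻¹ * y) = y := by group
    rw [h3] at h2
    rw [h4] at h1
    simp only [h1, h2, map_one, LinearMap.comp_apply, Module.End.one_apply])

variable {H : Subgroup G} {ρ : Representation R G V} {φ : G → Module.End R V}

@[simp]
theorem heckeTerm_mk (hφ : IsHeckeFunction H ρ φ) (f : ind H ρ) (g x : G) :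
    heckeTerm hφ f g (x : G ⧸ H) = φ x (f.1 (x⁻¹ * g)) := rfl

theorem heckeTerm_finite (hφ : IsHeckeFunction H ρ φ) (f : ind H ρ) (g : G) :
    (Function.support (heckeTerm hφ f g)).Finite := by
  obtain ⟨A, hA⟩ := f.2.2
  refine (A.finite_toSet.image fun a => ((g * a⁻¹ : G) : G ⧸ H)).subset ?_
  intro x hx
  induction x using QuotientGroup.induction_on with
  | H x =>
    have hx' : f.1 (x⁻¹ * g) ≠ 0 := by
      intro h0
      simp [h0] at hx
    obtain ⟨a, ha, hm⟩ := hA _ hx'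
    refine ⟨a, ha, ?_⟩
    rw [eq_comm, QuotientGroup.eq]
    simpa [mul_assoc] using hm

/-- The operator on `ind ρ` attached to `φ`:
`(T_φ f) g = ∑_{x H ∈ G ⧸ H} φ x (f (x⁻¹ g))`, a sum with finitely many nonzero terms. -/
def heckeOperator (hφ : IsHeckeFunction H ρ φ) : Module.End R (ind H ρ) where
  toFun f := ⟨fun g => ∑ᶠ x : G ⧸ H, heckeTerm hφ f g x, by
    constructor
    · intro κ hκ g
      have h1 : (ρ κ) (∑ᶠ x : G ⧸ H, heckeTerm hφ f g x)
          = ∑ᶠ x : G ⧸ H, ρ κ (heckeTerm hφ f g x) :=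
        AddMonoidHom.map_finsum (ρ κ).toAddMonoidHom (heckeTerm_finite hφ f g)
      change ∑ᶠ x : G ⧸ H, heckeTerm hφ f (κ * g) x = _
      rw [h1, ← finsum_comp_equiv (MulAction.toPerm κ : Equiv.Perm (G ⧸ H))]
      refine finsum_congr fun x => ?_
      induction x using QuotientGroup.induction_on with
      | H x =>
        have h2 := hφ.equivariant κ hκ 1 H.one_mem x
        have h3 : (κ * x)⁻¹ * (κ * g) = x⁻¹ * g := by group
        have h4 : (MulAction.toPerm κ : Equiv.Perm (G ⧸ H)) (x : G ⧸ H) = ((κ * x : G) : G ⧸ H) :=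
          rfl
        rw [h4, heckeTerm_mk, heckeTerm_mk, h3]
        rw [mul_one] at h2
        simp [h2]
    · classical
      obtain ⟨A, hA⟩ := hφ.finite_support
      obtain ⟨B, hB⟩ := f.2.2
      refine ⟨(A ×ˢ B).image fun c => c.1 * c.2, fun g hg => ?_⟩
      obtain ⟨x, hx⟩ : ∃ x, heckeTerm hφ f g x ≠ 0 := by
        by_contra! h0
        exact hg (by simp [h0])
      induction x using QuotientGroup.induction_on with
      | H x =>
        have hx1 : f.1 (x⁻¹ * g) ≠ 0 := by
          intro h0
          simp [h0] at hx
        obtain ⟨b, hb, hbm⟩ := hB _ hx1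
        set y := x⁻¹ * g * b⁻¹ with hy
        have hx2 : φ (x * y) ≠ 0 := by
          intro h0
          have h1 := hφ.equivariant 1 H.one_mem _ (H.inv_mem hbm) (x * y)
          have h2 : 1 * (x * y) * y⁻¹ = x := by group
          rw [h0, h2] at h1
          simp [h1] at hx
        obtain ⟨a, ha, ham⟩ := hA _ hx2
        refine ⟨a * b, Finset.mem_image.2 ⟨(a, b), Finset.mem_product.2 ⟨ha, hb⟩, rfl⟩, ?_⟩
        have h5 : g * (a * b)⁻¹ = x * y * a⁻¹ := by rw [hy]; group
        rwa [h5]⟩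
  map_add' f₁ f₂ := by
    ext g
    change ∑ᶠ x, heckeTerm hφ (f₁ + f₂) g x
      = ∑ᶠ x, heckeTerm hφ f₁ g x + ∑ᶠ x, heckeTerm hφ f₂ g x
    rw [← finsum_add_distrib (heckeTerm_finite hφ f₁ g) (heckeTerm_finite hφ f₂ g)]
    refine finsum_congr fun x => ?_
    induction x using QuotientGroup.induction_on with
    | H x => simp
  map_smul' c f := by
    ext g
    change ∑ᶠ x, heckeTerm hφ (c • f) g x = c • ∑ᶠ x, heckeTerm hφ f g x
    rw [smul_finsum' c (heckeTerm_finite hφ f g)]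
    refine finsum_congr fun x => ?_
    induction x using QuotientGroup.induction_on with
    | H x => simp

theorem heckeOperator_apply (hφ : IsHeckeFunction H ρ φ) (f : ind H ρ) (g : G) :
    (heckeOperator hφ f).1 g = ∑ᶠ x : G ⧸ H, heckeTerm hφ f g x := rfl

theorem heckeOperator_indRep (hφ : IsHeckeFunction H ρ φ) (g : G) (f : ind H ρ) :
    heckeOperator hφ (indRep H ρ g f) = indRep H ρ g (heckeOperator hφ f) := by
  ext g'
  change ∑ᶠ x, heckeTerm hφ (indRep H ρ g f) g' x = ∑ᶠ x, heckeTerm hφ f (g' * g) x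
  refine finsum_congr fun x => ?_
  induction x using QuotientGroup.induction_on with
  | H x =>
    change φ x (f.1 (x⁻¹ * g' * g)) = φ x (f.1 (x⁻¹ * (g' * g)))
    rw [mul_assoc]

/-- The subspace `(T_φ - a) (ind ρ)` of `ind ρ`. -/
def heckeRange (hφ : IsHeckeFunction H ρ φ) (a : R) : Submodule R (ind H ρ) :=
  LinearMap.range (heckeOperator hφ - a • LinearMap.id)

/-- The quotient `ind ρ / (T_φ - a) (ind ρ)`. -/
abbrev heckeQuotient (hφ : IsHeckeFunction H ρ φ) (a : R) : Type _ := ind H ρ ⧸ heckeRange hφ a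

theorem heckeRange_le_comap (hφ : IsHeckeFunction H ρ φ) (a : R) (g : G) :
    heckeRange hφ a ≤ (heckeRange hφ a).comap (indRep H ρ g) := by
  rintro _ ⟨f, rfl⟩
  refine ⟨indRep H ρ g f, ?_⟩
  simp [heckeOperator_indRep]

/-- The action of `G` on `ind ρ / (T_φ - a) (ind ρ)` induced by right translations. -/
def heckeQuotientRep (hφ : IsHeckeFunction H ρ φ) (a : R) :
    Representation R G (heckeQuotient hφ a) where
  toFun g := (heckeRange hφ a).mapQ (heckeRange hφ a) (indRep H ρ g) (heckeRange_le_comap hφ a g)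
  map_one' := by ext f; simp
  map_mul' g₁ g₂ := by ext f; simp

end Induction

/-! ### Lattices -/

section Lattice

variable {E V : Type*} [NormedField E] [IsUltrametricDist E] [AddCommGroup V] [Module E V]

/-- An `𝒪_E`-submodule `Λ` of an `E`-vector space `V` is a lattice if every vector of `V` has
a nonzero multiple in `Λ`. -/
def IsLattice (Λ : Submodule (integers E) V) : Prop :=
  ∀ v : V, ∃ a : E, a ≠ 0 ∧ a • v ∈ Λ

/-- A lattice `Λ` is separated if the intersection of all `ϖ_E ^ n Λ` is zero, for a uniformizer
`ϖ_E` of `E`. -/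
def IsSeparated (Λ : Submodule (integers E) V) : Prop :=
  ∀ ϖE : integers E, IsUniformizer ϖE → ⨅ n : ℕ, ϖE ^ n • Λ = ⊥

/-- `Λ` contains an `E`-line of `V`. -/
def ContainsLine (Λ : Submodule (integers E) V) : Prop :=
  ∃ W : Submodule E V, Module.finrank E W = 1 ∧ ∀ v ∈ W, v ∈ Λ

variable {G : Type*} [Group G]

/-- The functions in `ind ρ` with values in a lattice `Λ` of the space of `ρ`. -/
def indIntegral (H : Subgroup G) (ρ : Representation E G V) (Λ : Submodule (integers E) V) :
    Submodule (integers E) (ind H ρ) where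
  carrier := {f | ∀ g, f.1 g ∈ Λ}
  zero_mem' _ := Λ.zero_mem
  add_mem' h₁ h₂ g := Λ.add_mem (h₁ g) (h₂ g)
  smul_mem' c _ h g := Λ.smul_mem c (h g)

/-- The image of the functions with values in `Λ` in `ind ρ / (T_φ - a) (ind ρ)`. -/
def heckeLattice {H : Subgroup G} {ρ : Representation E G V} {φ : G → Module.End E V}
    (hφ : IsHeckeFunction H ρ φ) (a : E) (Λ : Submodule (integers E) V) :
    Submodule (integers E) (heckeQuotient hφ a) :=
  (indIntegral H ρ Λ).map ((heckeRange hφ a).mkQ.restrictScalars (integers E))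

end Lattice

/-! ### The representation `ρ_d` of `GL₂(F)` -/

section Rho

/-- The space of homogeneous polynomials of degree `n` in `x = X 0` and `y = X 1`. -/
abbrev Sym (E : Type*) [Field E] (n : ℕ) : Type _ :=
  MvPolynomial.homogeneousSubmodule (Fin 2) E n

/-- The monomial `x ^ (n - i) * y ^ i`. -/
def symMonomial (E : Type*) [Field E] (n : ℕ) (i : Fin (n + 1)) : Sym E n :=
  ⟨MvPolynomial.X 0 ^ (n - (i : ℕ)) * MvPolynomial.X 1 ^ (i : ℕ), by
    have h := ((MvPolynomial.isHomogeneous_X E (0 : Fin 2)).pow (n - (i : ℕ))).mul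
      ((MvPolynomial.isHomogeneous_X E (1 : Fin 2)).pow (i : ℕ))
    have h' : 1 * (n - (i : ℕ)) + 1 * (i : ℕ) = n := by
      have := i.2
      omega
    rwa [h'] at h⟩

/-- The substitution `x ↦ a x + c y`, `y ↦ b x + d y` on polynomials, for `m = !![a, b; c, d]`. -/
def substHom {E : Type*} [Field E] (m : Matrix (Fin 2) (Fin 2) E) :
    MvPolynomial (Fin 2) E →ₐ[E] MvPolynomial (Fin 2) E :=
  MvPolynomial.aeval fun j => ∑ i, MvPolynomial.C (m i j) * MvPolynomial.X i

/-- The action of a matrix on homogeneous polynomials of degree `n` by substitution. -/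
def symAction (E : Type*) [Field E] (n : ℕ) :
    Matrix (Fin 2) (Fin 2) E →* Module.End E (Sym E n) where
  toFun m := (substHom m).toLinearMap.restrict (by
    intro P hP
    have h := MvPolynomial.IsHomogeneous.aeval (m := n) hP
      (fun j => ∑ i, MvPolynomial.C (m i j) * MvPolynomial.X i)
      (n := 1) (fun j => MvPolynomial.IsHomogeneous.sum _ _ _ fun i _ =>
        MvPolynomial.isHomogeneous_C_mul_X _ _)
    rw [one_mul] at h
    exact h)
  map_one' := by
    ext P : 2
    have h : substHom (1 : Matrix (Fin 2) (Fin 2) E) = AlgHom.id E _ := by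
      ext j : 1
      fin_cases j <;> simp [substHom, Matrix.one_apply]
    change substHom 1 P.1 = P.1
    rw [h]
    rfl
  map_mul' m₁ m₂ := by
    ext P : 2
    have h : substHom (m₁ * m₂) = (substHom m₁).comp (substHom m₂) := by
      ext j : 1
      simp [substHom, Matrix.mul_apply, Fin.sum_univ_two]
      ring
    change substHom (m₁ * m₂) P.1 = substHom m₁ (substHom m₂ P.1)
    rw [h]
    rfl

theorem symAction_smul {E : Type*} [Field E] (n : ℕ) (c : E) (m : Matrix (Fin 2) (Fin 2) E) :
    symAction E n (c • m) = c ^ n • symAction E n m := by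
  ext P : 2
  change substHom (c • m) P.1 = c ^ n • substHom m P.1
  have hP := (MvPolynomial.mem_homogeneousSubmodule n P.1).1 P.2
  rw [P.1.as_sum, map_sum, map_sum, Finset.smul_sum]
  refine Finset.sum_congr rfl fun e he => ?_
  have hdeg : e 0 + e 1 = n := by
    have h := hP.degree_eq_sum_deg_support he
    rw [h, ← Fin.sum_univ_two (f := fun i => e i)]
    exact (Finset.sum_subset (Finset.subset_univ _) (by simp)).symm
  rw [substHom, substHom, MvPolynomial.aeval_monomial, MvPolynomial.aeval_monomial,
    Finsupp.prod_fintype _ _ (by simp), Finsupp.prod_fintype _ _ (by simp)]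
  have hlin : ∀ j, (∑ i, MvPolynomial.C ((c • m) i j) * MvPolynomial.X i :
      MvPolynomial (Fin 2) E) = MvPolynomial.C c * ∑ i, MvPolynomial.C (m i j) *
        MvPolynomial.X i := fun j => by
    simp [Fin.sum_univ_two]
    ring
  simp only [hlin, mul_pow, Fin.prod_univ_two, MvPolynomial.smul_eq_C_mul, ← hdeg, pow_add,
    map_mul, map_pow]
  ring

variable {p : ℕ} [Fact p.Prime]
variable {F : Type*} [NormedField F] [IsUltrametricDist F] [NormedAlgebra ℚ_[p] F]
variable {E : Type*} [NormedField E] [IsUltrametricDist E] [NormedAlgebra ℚ_[p] E]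

/-- `s σ` is a square root of `σ(ϖ)` for every embedding `σ` for which `d σ` is odd. -/
def IsSqrtChoice (ϖ : integers F) (d : (F →ₐ[ℚ_[p]] E) → ℕ) (s : (F →ₐ[ℚ_[p]] E) → E) : Prop :=
  ∀ σ, Odd (d σ) → s σ ^ 2 = σ ϖ

/-- The element `σ(ϖ) ^ (d_σ / 2)` of `E`, where `σ(ϖ) ^ (1 / 2)` means `s σ` if `d_σ` is odd. -/
def halfPow (ϖ : integers F) (d : (F →ₐ[ℚ_[p]] E) → ℕ) (s : (F →ₐ[ℚ_[p]] E) → E)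
    (σ : F →ₐ[ℚ_[p]] E) : E :=
  if Even (d σ) then σ ϖ ^ (d σ / 2) else s σ ^ d σ

theorem halfPow_sq {ϖ : integers F} {d : (F →ₐ[ℚ_[p]] E) → ℕ} {s : (F →ₐ[ℚ_[p]] E) → E}
    (hs : IsSqrtChoice ϖ d s) (σ : F →ₐ[ℚ_[p]] E) : halfPow ϖ d s σ ^ 2 = σ ϖ ^ d σ := by
  unfold halfPow
  split_ifs with h
  · rw [← pow_mul, Nat.div_mul_cancel h.two_dvd]
  · rw [← pow_mul, mul_comm, pow_mul, hs σ (Nat.not_even_iff_odd.1 h)]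

theorem halfPow_ne_zero {ϖ : integers F} {d : (F →ₐ[ℚ_[p]] E) → ℕ} {s : (F →ₐ[ℚ_[p]] E) → E}
    (hϖ : IsUniformizer ϖ) (hs : IsSqrtChoice ϖ d s) (σ : F →ₐ[ℚ_[p]] E) :
    halfPow ϖ d s σ ≠ 0 := by
  intro h
  have h1 := halfPow_sq hs σ
  rw [h, zero_pow two_ne_zero] at h1
  exact pow_ne_zero _ ((map_ne_zero σ).2 hϖ.coe_ne_zero) h1.symm

/-- The representation of `GL₂(F)` on homogeneous polynomials of degree `d_σ`: the matrix
`!![a, b; c, d]` acts by `x ↦ σ(a) x + σ(c) y`, `y ↦ σ(b) x + σ(d) y`, multiplied by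
`σ(ϖ) ^ (- v(det) d_σ / 2)`, where `v` is normalized by `v(ϖ) = 1`. -/
def symRep {ϖ : integers F} {d : (F →ₐ[ℚ_[p]] E) → ℕ} {s : (F →ₐ[ℚ_[p]] E) → E}
    (hϖ : IsUniformizer ϖ) (hs : IsSqrtChoice ϖ d s) (σ : F →ₐ[ℚ_[p]] E) :
    Representation E (GL (Fin 2) F) (Sym E (d σ)) where
  toFun g := halfPow ϖ d s σ ^ (-ord ϖ (g : Matrix (Fin 2) (Fin 2) F).det) •
    symAction E (d σ) ((g : Matrix (Fin 2) (Fin 2) F).map σ)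
  map_one' := by simp [hϖ.ord_one]
  map_mul' g₁ g₂ := by
    have hd : ∀ g : GL (Fin 2) F, (g : Matrix (Fin 2) (Fin 2) F).det ≠ 0 := fun g =>
      (Matrix.isUnit_iff_isUnit_det _).1 g.isUnit |>.ne_zero
    rw [Units.val_mul, Matrix.det_mul, hϖ.ord_mul (hd _) (hd _), neg_add,
      zpow_add₀ (halfPow_ne_zero hϖ hs σ), Matrix.map_mul, map_mul, smul_mul_smul_comm]

/-- The underlying space of `ρ_d`: the tensor product over the embeddings `σ : F → E` of the
spaces of homogeneous polynomials of degree `d_σ`. -/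
def RhoSpace (d : (F →ₐ[ℚ_[p]] E) → ℕ) : Type _ := ⨂[E] σ : F →ₐ[ℚ_[p]] E, Sym E (d σ)

instance (d : (F →ₐ[ℚ_[p]] E) → ℕ) : AddCommGroup (RhoSpace d) :=
  inferInstanceAs (AddCommGroup (⨂[E] σ : F →ₐ[ℚ_[p]] E, Sym E (d σ)))

instance (d : (F →ₐ[ℚ_[p]] E) → ℕ) : Module E (RhoSpace d) :=
  inferInstanceAs (Module E (⨂[E] σ : F →ₐ[ℚ_[p]] E, Sym E (d σ)))

/-- The tensor product of endomorphisms of the spaces of homogeneous polynomials. -/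
def rhoMap (d : (F →ₐ[ℚ_[p]] E) → ℕ) :
    ((σ : F →ₐ[ℚ_[p]] E) → Module.End E (Sym E (d σ))) →* Module.End E (RhoSpace d) where
  toFun u := PiTensorProduct.map u
  map_one' := PiTensorProduct.map_one
  map_mul' := PiTensorProduct.map_mul

/-- The representation `ρ_d` of `GL₂(F)`, the tensor product of the representations `symRep`. -/
def rho {ϖ : integers F} {d : (F →ₐ[ℚ_[p]] E) → ℕ} {s : (F →ₐ[ℚ_[p]] E) → E}
    (hϖ : IsUniformizer ϖ) (hs : IsSqrtChoice ϖ d s) :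
    Representation E (GL (Fin 2) F) (RhoSpace d) where
  toFun g := rhoMap d fun σ => symRep hϖ hs σ g
  map_one' := by
    simp only [map_one]
    exact map_one (rhoMap d)
  map_mul' g₁ g₂ := by
    simp only [map_mul]
    exact map_mul (rhoMap d) _ _

/-- The vector `e_{d,i} = ⨂_σ x_σ ^ (d_σ - i_σ) y_σ ^ i_σ`. -/
def rhoMonomial (d : (F →ₐ[ℚ_[p]] E) → ℕ) (i : (σ : F →ₐ[ℚ_[p]] E) → Fin (d σ + 1)) :
    RhoSpace d :=
  PiTensorProduct.tprod E fun σ => symMonomial E (d σ) (i σ)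

/-- The `𝒪_E`-lattice `ρ_d⁰` in the space of `ρ_d`, with basis the vectors `e_{d,i}`. -/
def rhoIntegral (d : (F →ₐ[ℚ_[p]] E) → ℕ) : Submodule (integers E) (RhoSpace d) :=
  Submodule.span (integers E) (Set.range (rhoMonomial d))

end Rho

/-! ### The operator `T` -/

section Hecke

/-- The subgroup `GL₂(𝒪_F)` of `GL₂(F)`. -/
def maxCompact (F : Type*) [NormedField F] [IsUltrametricDist F] : Subgroup (GL (Fin 2) F) :=
  (Matrix.GeneralLinearGroup.map (n := Fin 2) (integers F).subtype).range

/-- The subgroup `KZ` of `GL₂(F)`, where `K = GL₂(𝒪_F)` and `Z` is the centre. -/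
def KZ (F : Type*) [NormedField F] [IsUltrametricDist F] : Subgroup (GL (Fin 2) F) :=
  maxCompact F ⊔ Subgroup.center (GL (Fin 2) F)

/-- The matrix `α = !![1, 0; 0, ϖ]`. -/
def alpha {F : Type*} [NormedField F] [IsUltrametricDist F] {ϖ : integers F}
    (hϖ : IsUniformizer ϖ) : GL (Fin 2) F :=
  Matrix.GeneralLinearGroup.mkOfDetNeZero !![1, 0; 0, (ϖ : F)]
    (by simpa [Matrix.det_fin_two] using hϖ.coe_ne_zero)

variable {p : ℕ} [Fact p.Prime]
variable {F : Type*} [NormedField F] [IsUltrametricDist F] [NormedAlgebra ℚ_[p] F]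
variable {E : Type*} [NormedField E] [IsUltrametricDist E] [NormedAlgebra ℚ_[p] E]
variable {ϖ : integers F} {d : (F →ₐ[ℚ_[p]] E) → ℕ} {s : (F →ₐ[ℚ_[p]] E) → E}

/-- The endomorphism `U_d` of the space of `ρ_d`: the tensor product over `σ` of the substitutions
`x ↦ σ(ϖ) x`, `y ↦ y`, so that `U_d e_{d,i} = (∏_σ σ(ϖ) ^ (d_σ - i_σ)) e_{d,i}`. -/
def Ud (ϖ : integers F) (d : (F →ₐ[ℚ_[p]] E) → ℕ) : Module.End E (RhoSpace d) :=
  rhoMap d fun σ => symAction E (d σ) !![σ ϖ, 0; 0, 1]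

/-- The function `ψ` on `GL₂(F)` with support in `KZ α⁻¹ KZ` such that
`ψ (κ₁ α⁻¹ κ₂) = ρ_d(κ₁) ∘ U_d ∘ ρ_d(κ₂)` for `κ₁, κ₂ ∈ KZ`; see `psi_apply`. Explicitly, it is
`(∏_σ σ(ϖ) ^ (d_σ / 2)) ρ_d` on `KZ α⁻¹ KZ`. -/
def psi (hϖ : IsUniformizer ϖ) (hs : IsSqrtChoice ϖ d s) (g : GL (Fin 2) F) :
    Module.End E (RhoSpace d) :=
  open Classical in
  if g ∈ DoubleCoset.doubleCoset (alpha hϖ)⁻¹ (KZ F : Set (GL (Fin 2) F)) (KZ F) then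
    rhoMap d fun σ => halfPow ϖ d s σ • symRep hϖ hs σ g
  else 0

theorem alpha_inv_val (hϖ : IsUniformizer ϖ) :
    ((alpha hϖ)⁻¹ : GL (Fin 2) F).val = !![1, 0; 0, (ϖ : F)⁻¹] := by
  have h1 : (alpha hϖ).val * !![1, 0; 0, (ϖ : F)⁻¹] = 1 := by
    ext i j
    fin_cases i <;> fin_cases j <;>
      simp [alpha, Matrix.GeneralLinearGroup.mkOfDetNeZero, Matrix.mul_apply, hϖ.coe_ne_zero]
  calc ((alpha hϖ)⁻¹ : GL (Fin 2) F).val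
      = ((alpha hϖ)⁻¹ : GL (Fin 2) F).val * ((alpha hϖ).val * !![1, 0; 0, (ϖ : F)⁻¹]) := by
        rw [h1, mul_one]
    _ = !![1, 0; 0, (ϖ : F)⁻¹] := by
        rw [← mul_assoc, ← Units.val_mul, inv_mul_cancel, Units.val_one, one_mul]

theorem psi_alpha_inv (hϖ : IsUniformizer ϖ) (hs : IsSqrtChoice ϖ d s) :
    psi hϖ hs (alpha hϖ)⁻¹ = Ud ϖ d := by
  have hord : ord ϖ ((alpha hϖ)⁻¹ : GL (Fin 2) F).val.det = -1 := by
    rw [alpha_inv_val, Matrix.det_fin_two]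
    exact hϖ.ord_eq (by simp)
  have hmem : (alpha hϖ)⁻¹ ∈
      DoubleCoset.doubleCoset (alpha hϖ)⁻¹ (KZ F : Set (GL (Fin 2) F)) (KZ F) :=
    DoubleCoset.mem_doubleCoset.2 ⟨1, (KZ F).one_mem, 1, (KZ F).one_mem, by simp⟩
  rw [psi, if_pos hmem, Ud]
  congr 1
  funext σ
  have h0 : σ ϖ ≠ 0 := (map_ne_zero σ).2 hϖ.coe_ne_zero
  change halfPow ϖ d s σ • (halfPow ϖ d s σ ^ (-ord ϖ ((alpha hϖ)⁻¹ : GL (Fin 2) F).val.det) •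
    symAction E (d σ) (((alpha hϖ)⁻¹ : GL (Fin 2) F).val.map σ)) = _
  rw [hord, neg_neg, zpow_one, smul_smul, ← sq, halfPow_sq hs, alpha_inv_val]
  have h1 : !![σ ϖ, 0; 0, 1] = σ ϖ • (!![1, 0; 0, (ϖ : F)⁻¹] : Matrix (Fin 2) (Fin 2) F).map σ := by
    ext i j
    fin_cases i <;> fin_cases j <;> simp [h0]
  rw [h1, symAction_smul]

theorem mem_doubleCoset_KZ_iff {κ₁ κ₂ : GL (Fin 2) F} (h₁ : κ₁ ∈ KZ F) (h₂ : κ₂ ∈ KZ F)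
    (g b : GL (Fin 2) F) :
    κ₁ * g * κ₂ ∈ DoubleCoset.doubleCoset b (KZ F : Set (GL (Fin 2) F)) (KZ F) ↔
      g ∈ DoubleCoset.doubleCoset b (KZ F : Set (GL (Fin 2) F)) (KZ F) := by
  simp only [DoubleCoset.mem_doubleCoset, SetLike.mem_coe]
  constructor
  · rintro ⟨x, hx, y, hy, h⟩
    refine ⟨κ₁⁻¹ * x, mul_mem (inv_mem h₁) hx, y * κ₂⁻¹, mul_mem hy (inv_mem h₂), ?_⟩
    calc g = κ₁⁻¹ * (κ₁ * g * κ₂) * κ₂⁻¹ := by group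
      _ = _ := by rw [h]; group
  · rintro ⟨x, hx, y, hy, rfl⟩
    exact ⟨κ₁ * x, mul_mem h₁ hx, y * κ₂, mul_mem hy h₂, by group⟩

theorem psi_apply (hϖ : IsUniformizer ϖ) (hs : IsSqrtChoice ϖ d s) {κ₁ κ₂ : GL (Fin 2) F}
    (h₁ : κ₁ ∈ KZ F) (h₂ : κ₂ ∈ KZ F) (g : GL (Fin 2) F) :
    psi hϖ hs (κ₁ * g * κ₂) = rho hϖ hs κ₁ ∘ₗ psi hϖ hs g ∘ₗ rho hϖ hs κ₂ := by
  unfold psi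
  by_cases hg : g ∈ DoubleCoset.doubleCoset (alpha hϖ)⁻¹ (KZ F : Set (GL (Fin 2) F)) (KZ F)
  · rw [if_pos hg, if_pos ((mem_doubleCoset_KZ_iff h₁ h₂ g _).2 hg)]
    change _ = rhoMap d _ * (rhoMap d _ * rhoMap d _)
    rw [← map_mul, ← map_mul]
    congr 1
    funext σ
    simp only [Pi.mul_apply, map_mul, smul_mul_assoc, mul_smul_comm, mul_assoc]
  · rw [if_neg hg, if_neg fun h => hg ((mem_doubleCoset_KZ_iff h₁ h₂ g _).1 h)]
    simp

theorem finite_residueField (p : ℕ) [Fact p.Prime] (F : Type*) [NormedField F]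
    [IsUltrametricDist F] [NormedAlgebra ℚ_[p] F] [FiniteDimensional ℚ_[p] F] :
    Finite (IsLocalRing.ResidueField (integers F)) := by
  have hproper : ProperSpace F := FiniteDimensional.proper ℚ_[p] F
  obtain ⟨t, ht, hfin, hcov⟩ :=
    (isCompact_closedBall (0 : F) 1).finite_cover_balls one_pos
  have ht' : ∀ x ∈ t, x ∈ integers F := fun x hx => by
    rw [mem_integers]
    simpa using ht hx
  have hfin' : Finite t := hfin
  refine Finite.of_surjective
    (fun x : t => IsLocalRing.residue (integers F) ⟨x.1, ht' x.1 x.2⟩) fun y => ?_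
  obtain ⟨y, rfl⟩ := IsLocalRing.residue_surjective y
  have hy : (y : F) ∈ Metric.closedBall (0 : F) 1 := by simpa using mem_integers.1 y.2
  obtain ⟨x, hx, hxy⟩ := Set.mem_iUnion₂.1 (hcov hy)
  refine ⟨⟨x, hx⟩, ?_⟩
  rw [← sub_eq_zero, ← map_sub, IsLocalRing.residue_eq_zero_iff, mem_maximalIdeal_iff]
  rw [Metric.mem_ball, dist_comm, dist_eq_norm] at hxy
  exact hxy

/-- If the reduction of `k ∈ GL₂(𝒪_F)` is upper triangular, then `α⁻¹ k α` belongs to `KZ`. -/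
theorem conj_mem_KZ (hϖ : IsUniformizer ϖ) (k : GL (Fin 2) (integers F))
    (hk : k.val 1 0 ∈ IsLocalRing.maximalIdeal (integers F)) :
    (alpha hϖ)⁻¹ * Matrix.GeneralLinearGroup.map (integers F).subtype k * alpha hϖ ∈ KZ F := by
  rw [hϖ.2, Ideal.mem_span_singleton] at hk
  obtain ⟨c, hc⟩ := hk
  have hdet : IsUnit (!![k.val 0 0, k.val 0 1 * ϖ; c, k.val 1 1] :
      Matrix (Fin 2) (Fin 2) (integers F)).det := by
    have h := (Matrix.isUnit_iff_isUnit_det _).1 k.isUnit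
    rw [Matrix.det_fin_two, hc] at h
    rw [Matrix.det_fin_two_of]
    convert h using 1
    ring
  obtain ⟨u, hu⟩ := (Matrix.isUnit_iff_isUnit_det _).2 hdet
  refine Subgroup.mem_sup_left ⟨u, ?_⟩
  rw [mul_assoc, eq_inv_mul_iff_mul_eq]
  have hc' : ((k.val 1 0 : integers F) : F) = ϖ * c := congrArg Subtype.val hc
  ext i j
  fin_cases i <;> fin_cases j <;>
    simp [alpha, Matrix.GeneralLinearGroup.mkOfDetNeZero, Matrix.mul_apply, Fin.sum_univ_two, hu,
      hc']
  exact mul_comm _ _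

theorem psi_finite_support [FiniteDimensional ℚ_[p] F] (hϖ : IsUniformizer ϖ)
    (hs : IsSqrtChoice ϖ d s) : HasFiniteSupportMod (KZ F) (psi hϖ hs) := by
  classical
  have hres := finite_residueField p F
  let r := Matrix.GeneralLinearGroup.map (n := Fin 2) (IsLocalRing.residue (integers F))
  let φ := Matrix.GeneralLinearGroup.map (n := Fin 2) (integers F).subtype
  have hfin : (Set.range fun y : Set.range r => (alpha hϖ)⁻¹ * φ y.2.choose).Finite :=
    Set.finite_range _
  refine ⟨hfin.toFinset, fun g hg => ?_⟩
  have hmem : g ∈ DoubleCoset.doubleCoset (alpha hϖ)⁻¹ (KZ F : Set (GL (Fin 2) F)) (KZ F) := by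
    by_contra h
    exact hg (if_neg h)
  obtain ⟨κ₁, h₁, κ₂, h₂, rfl⟩ := DoubleCoset.mem_doubleCoset.1 hmem
  obtain ⟨_, ⟨k, rfl⟩, z, hz, rfl⟩ := Subgroup.mem_sup_of_normal_right.1 h₂
  let y : Set.range r := ⟨r k, k, rfl⟩
  refine ⟨(alpha hϖ)⁻¹ * φ y.2.choose, hfin.mem_toFinset.2 ⟨y, rfl⟩, ?_⟩
  have hr : r (k * y.2.choose⁻¹) = 1 := by
    rw [map_mul, map_inv, y.2.choose_spec, mul_inv_cancel]
  have hk : (k * y.2.choose⁻¹).val 1 0 ∈ IsLocalRing.maximalIdeal (integers F) := by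
    rw [← IsLocalRing.residue_eq_zero_iff]
    have h := congrArg (fun m : GL (Fin 2) (IsLocalRing.ResidueField (integers F)) => m.val 1 0) hr
    exact h.trans (by simp)
  have hconj := conj_mem_KZ hϖ _ hk
  have hzc := Subgroup.mem_center_iff.1 hz
  have heq : κ₁ * (alpha hϖ)⁻¹ * (φ k * z) * ((alpha hϖ)⁻¹ * φ y.2.choose)⁻¹
      = κ₁ * z * ((alpha hϖ)⁻¹ * φ (k * y.2.choose⁻¹) * alpha hϖ) := by
    rw [map_mul, map_inv, hzc (φ k)]
    calc _ = κ₁ * ((alpha hϖ)⁻¹ * z) * φ k * (φ y.2.choose)⁻¹ * alpha hϖ := by group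
      _ = _ := by rw [hzc]; group
  have hz' : z ∈ KZ F := Subgroup.mem_sup_right hz
  have := mul_mem (mul_mem h₁ hz') hconj
  rw [← heq] at this
  exact this

/-- The function `ψ` is an element of the Hecke algebra of `KZ` and `ρ_d`. -/
theorem psi_isHeckeFunction [FiniteDimensional ℚ_[p] F] (hϖ : IsUniformizer ϖ)
    (hs : IsSqrtChoice ϖ d s) : IsHeckeFunction (R := E) (V := RhoSpace d) (KZ F) (rho hϖ hs) (psi hϖ hs) where
  equivariant _ h₁ _ h₂ g := psi_apply hϖ hs h₁ h₂ g
  finite_support := psi_finite_support hϖ hs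

variable [FiniteDimensional ℚ_[p] F]

/-- The space `Π_{d,a_p} = ind ρ_d / (T - a_p) (ind ρ_d)`, where `T` is the operator
attached to `ψ`. -/
abbrev PiSpace (hϖ : IsUniformizer ϖ) (hs : IsSqrtChoice ϖ d s) (a : E) : Type _ :=
  heckeQuotient (psi_isHeckeFunction hϖ hs) a

/-- The action of `GL₂(F)` on `Π_{d,a_p}`. -/
def piRep (hϖ : IsUniformizer ϖ) (hs : IsSqrtChoice ϖ d s) (a : E) :
    Representation E (GL (Fin 2) F) (PiSpace hϖ hs a) :=
  heckeQuotientRep (psi_isHeckeFunction hϖ hs) a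

/-- The image `Θ_{d,a_p}` of `ind ρ_d⁰` in `Π_{d,a_p}`. -/
def Theta (hϖ : IsUniformizer ϖ) (hs : IsSqrtChoice ϖ d s) (a : E) :
    Submodule (integers E) (PiSpace hϖ hs a) :=
  heckeLattice (psi_isHeckeFunction hϖ hs) a (rhoIntegral d)

end Hecke

/-! ### The conditions on `d` -/

section Conditions

variable {p : ℕ} [Fact p.Prime]
variable {F : Type*} [Field F] [Algebra ℚ_[p] F]
variable {E : Type*} [Field E] [Algebra ℚ_[p] E]

/-- The set `J_l` of the embeddings `σ` with `d_σ ≠ 0` such that `σ(λ) = ι(λ) ^ (p ^ l)` for all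
Teichmüller representatives `λ` of the residue field of `F`, which has `p ^ f` elements. -/
def J (f : ℕ) (ι : F →ₐ[ℚ_[p]] E) (d : (F →ₐ[ℚ_[p]] E) → ℕ) (l : ℕ) : Set (F →ₐ[ℚ_[p]] E) :=
  {σ | d σ ≠ 0 ∧ ∀ x ∈ teichmullerSet F (p ^ f), σ x = ι x ^ p ^ l}

/-- The integer `v_σ` for `σ ∈ J_l`: the least `i` with `1 ≤ i ≤ f` such that `J_{l + i}` is
nonempty, where the index `l + i` is read modulo `f`. -/
def gap (f : ℕ) (ι : F →ₐ[ℚ_[p]] E) (d : (F →ₐ[ℚ_[p]] E) → ℕ) (l : ℕ) : ℕ :=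
  sInf {i | 1 ≤ i ∧ i ≤ f ∧ (J f ι d ((l + i) % f)).Nonempty}

end Conditions

end

end BreuilLattice

set_option linter.unusedSectionVars false

namespace BreuilLattice

noncomputable section

/-! ### Embeddings of local fields and Teichmüller representatives -/

section Embeddings

variable {p : ℕ} [Fact p.Prime]
variable {F : Type*} [NormedField F] [NormedAlgebra ℚ_[p] F] [FiniteDimensional ℚ_[p] F]
variable {E : Type*} [NormedField E] [NormedAlgebra ℚ_[p] E]

/-! The cosets `KZ y` are the vertices of the Bruhat-Tits tree, and `T` sums over the `q + 1`
neighbours of a vertex. Stability and the lattice property are formal; the content is separatedness.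
If the class of `h₀` lies in every `c ^ n Θ`, then `(T - a) h_n = h₀ - g_n` with `g_n` of size `‖c‖
^ n`. It suffices to find a finite set `B` of vertices, independent of `n`, off which `h_n` is also
of size `‖c‖ ^ n`. Truncating `h_n` to `B` then exhibits `h₀` as a limit of elements of a fixed
finite-dimensional subspace of the range of `T - a`; such a subspace is closed, so `h₀` lies in it
(`mem_heckeRange_of_forall_exists`).

To find `B`, fix an end of the tree. `height 0` is the exponential of a Busemann function: each
vertex has one neighbour of smaller height, and the others have height larger by the factor `1 /
‖ϖ‖`. Since `h_n` vanishes at large heights, one descends. At a vertex `z` just above `y`, every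
contribution to `(T - a) h_n` except that of `y` is already known to be small, so `ψ(α) ρ(unip μ)
(h_n y)` is small for all integral `μ` (`mem_rhoBall_of_heckeOperator_sub_mem`). Doing this for two
ends controls `h_n` off the intersection of two horoballs, which is finite
(`exists_finset_of_height_le`).

The conditions on `d` serve to pass from these vectors back to `h_n y` without loss
(`norm_le_of_forall_norm_sum_le`). If `h_n y` has coordinates `c_i`, one coordinate of the vector is
`∑ c_i ∏ σ(μ) ^ i_σ`. On Teichmüller `μ` all `σ(μ)` are powers of one `τ(μ)`, and the two conditions
place the `i_σ` in disjoint blocks of base-`p` digits. The sum is thus a polynomial in `τ(μ)` with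
distinct exponents below `q`; bounded at `q` points at mutual distance one, it has bounded
coefficients. -/

theorem norm_algHom_le (σ : F →ₐ[ℚ_[p]] E) (x : F) : ‖σ x‖ ≤ ‖x‖ := by
  let L : F →L[ℚ_[p]] E := ⟨σ.toLinearMap, σ.toLinearMap.continuous_of_finiteDimensional⟩
  by_contra! hlt
  have hx : 0 < ‖x‖ := norm_pos_iff.2 fun h => by simp [h] at hlt
  -- Both norms are multiplicative, so a ratio above `1` would outgrow the operator norm on powers
  -- of `x`.
  obtain ⟨n, hn⟩ := pow_unbounded_of_one_lt ‖L‖ ((one_lt_div hx).2 hlt)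
  have h := L.le_opNorm (x ^ n)
  change ‖σ (x ^ n)‖ ≤ _ at h
  rw [map_pow, norm_pow, norm_pow] at h
  rw [div_pow, lt_div_iff₀ (pow_pos hx n)] at hn
  linarith

theorem norm_algHom (σ : F →ₐ[ℚ_[p]] E) (x : F) : ‖σ x‖ = ‖x‖ := by
  refine le_antisymm (norm_algHom_le σ x) ?_
  by_cases hx : x = 0
  · simp [hx]
  have h := norm_algHom_le σ x⁻¹
  rw [map_inv₀, norm_inv, norm_inv] at h
  exact (inv_le_inv₀ (norm_pos_iff.2 ((map_ne_zero σ).2 hx)) (norm_pos_iff.2 hx)).1 h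

end Embeddings

/-! ### Roots of `X ^ q - X` as fixed points of a contraction, and interpolation at separated points
-/

section Teichmuller

variable {L : Type*} [NormedField L] [IsUltrametricDist L]

theorem norm_add_le_of_le {x y : L} {δ : ℝ} (hx : ‖x‖ ≤ δ) (hy : ‖y‖ ≤ δ) : ‖x + y‖ ≤ δ :=
  (IsUltrametricDist.norm_add_le_max x y).trans (max_le hx hy)

theorem norm_sub_le_of_le {x y : L} {δ : ℝ} (hx : ‖x‖ ≤ δ) (hy : ‖y‖ ≤ δ) : ‖x - y‖ ≤ δ := by
  rw [sub_eq_add_neg]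
  exact norm_add_le_of_le hx (by rwa [norm_neg])

/-- This is the cofactor of `x - y` in `x ^ q - y ^ q`. Replacing each `x ^ i` by `y ^ i` costs
multiples of `x - y` and leaves `q * y ^ (q - 1)`. Hence `x ↦ x ^ q` contracts by `r` the distance
of integral points at distance at most `r`. -/
theorem norm_geom_sum_le {x y : L} (hx : ‖x‖ ≤ 1) (hy : ‖y‖ ≤ 1) {r : ℝ} {q : ℕ}
    (hq : ‖(q : L)‖ ≤ r) (hxy : ‖x - y‖ ≤ r) :
    ‖∑ i ∈ Finset.range q, x ^ i * y ^ (q - 1 - i)‖ ≤ r := by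
  have hr : 0 ≤ r := (norm_nonneg _).trans hq
  have h1 : ∑ i ∈ Finset.range q, x ^ i * y ^ (q - 1 - i)
      = ∑ i ∈ Finset.range q, (x ^ i - y ^ i) * y ^ (q - 1 - i) + q * y ^ (q - 1) := by
    have h2 : (q : L) * y ^ (q - 1) = ∑ i ∈ Finset.range q, y ^ i * y ^ (q - 1 - i) := by
      rw [Finset.sum_congr rfl (g := fun _ => y ^ (q - 1)), Finset.sum_const, Finset.card_range,
        nsmul_eq_mul]
      intro i hi
      rw [← pow_add]
      congr 1
      have := Finset.mem_range.1 hi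
      omega
    rw [h2, ← Finset.sum_add_distrib]
    exact Finset.sum_congr rfl fun i _ => by ring
  rw [h1]
  refine norm_add_le_of_le (IsUltrametricDist.norm_sum_le_of_forall_le_of_nonneg hr fun i _ => ?_) ?_
  · rw [norm_mul, ← (Commute.all x y).geom_sum₂_mul i, norm_mul]
    have h3 : ‖∑ j ∈ Finset.range i, x ^ j * y ^ (i - 1 - j)‖ ≤ 1 := by
      refine IsUltrametricDist.norm_sum_le_of_forall_le_of_nonneg zero_le_one fun j _ => ?_
      rw [norm_mul, norm_pow, norm_pow]
      exact mul_le_one₀ (pow_le_one₀ (norm_nonneg _) hx) (by positivity)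
        (pow_le_one₀ (norm_nonneg _) hy)
    have h4 : ‖y ^ (q - 1 - i)‖ ≤ 1 := by
      rw [norm_pow]
      exact pow_le_one₀ (norm_nonneg _) hy
    calc _ ≤ 1 * r * 1 := by gcongr
      _ = r := by ring
  · rw [norm_mul, norm_pow]
    calc _ ≤ r * 1 := by
          gcongr
          exact pow_le_one₀ (norm_nonneg _) hy
      _ = r := mul_one r

theorem norm_pow_sub_pow_le {x y : L} (hx : ‖x‖ ≤ 1) (hy : ‖y‖ ≤ 1) {r : ℝ} {q : ℕ}
    (hq : ‖(q : L)‖ ≤ r) (hxy : ‖x - y‖ ≤ r) : ‖x ^ q - y ^ q‖ ≤ r * ‖x - y‖ := by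
  rw [← (Commute.all x y).geom_sum₂_mul q, norm_mul]
  gcongr
  exact norm_geom_sum_le hx hy hq hxy

omit [IsUltrametricDist L] in
theorem teichmullerSet_norm_le {q : ℕ} (hq : 1 < q) {x : L} (hx : x ∈ teichmullerSet L q) :
    ‖x‖ ≤ 1 := by
  have hx' : x ^ q = x := hx
  by_contra! h
  have h1 := congrArg norm hx'
  rw [norm_pow] at h1
  have h2 := pow_lt_pow_right₀ h hq
  rw [pow_one] at h2
  linarith

theorem teichmullerSet_eq_of_norm_sub_lt {q : ℕ} (hq1 : 1 < q) (hq : ‖(q : L)‖ < 1) {x y : L}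
    (hx : x ∈ teichmullerSet L q) (hy : y ∈ teichmullerSet L q) (hxy : ‖x - y‖ < 1) : x = y := by
  have hx1 := teichmullerSet_norm_le hq1 hx
  have hy1 := teichmullerSet_norm_le hq1 hy
  by_contra hne
  have h := norm_pow_sub_pow_le hx1 hy1 (le_max_left ‖(q : L)‖ ‖x - y‖) (le_max_right _ _)
  rw [show x ^ q = x from hx, show y ^ q = y from hy] at h
  have h1 : 0 < ‖x - y‖ := norm_pos_iff.2 (sub_ne_zero.2 hne)
  nlinarith [max_lt hq hxy]

/-- By the contraction property the iterates `x ^ q ^ n` form a Cauchy sequence, whose limit is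
fixed by `x ↦ x ^ q`. -/
theorem exists_teichmuller [CompleteSpace L] {q : ℕ} {r : ℝ} (hr : r < 1)
    (hq : ‖(q : L)‖ ≤ r) {x : L} (hx : ‖x‖ ≤ 1) (hxq : ‖x ^ q - x‖ ≤ r) :
    ∃ y ∈ teichmullerSet L q, ‖y - x‖ ≤ r := by
  have hr0 : 0 ≤ r := (norm_nonneg _).trans hq
  let u : ℕ → L := fun n => x ^ q ^ n
  have hu : ∀ n, ‖u n‖ ≤ 1 := fun n => by
    rw [norm_pow]
    exact pow_le_one₀ (norm_nonneg _) hx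
  have hus : ∀ n, u (n + 1) = u n ^ q := fun n => by simp only [u, pow_succ, pow_mul]
  have hd : ∀ n, ‖u (n + 1) - u n‖ ≤ r * r ^ n := by
    intro n
    induction n with
    | zero => simpa [u] using hxq
    | succ n ih =>
      have h1 : r * r ^ n ≤ r := mul_le_of_le_one_right hr0 (pow_le_one₀ hr0 hr.le)
      rw [hus (n + 1), hus n, pow_succ', ← hus n]
      have h2 := norm_pow_sub_pow_le (hu (n + 1)) (hu n) hq (ih.trans h1)
      rw [← hus n] at h2
      exact h2.trans (mul_le_mul_of_nonneg_left ih hr0)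
  have hcauchy : CauchySeq u := cauchySeq_of_le_geometric r r hr fun n => by
    rw [dist_comm, dist_eq_norm]
    exact hd n
  obtain ⟨y, hy⟩ := cauchySeq_tendsto_of_complete hcauchy
  refine ⟨y, ?_, ?_⟩
  · have h1 := (hy.comp (Filter.tendsto_add_atTop_nat 1))
    have h2 := hy.pow q
    refine tendsto_nhds_unique h2 ?_
    convert h1 using 2 with n
    exact (hus n).symm
  · have h1 : ∀ n, ‖u n - x‖ ≤ r := by
      intro n
      induction n with
      | zero => simpa [u] using hr0
      | succ n ih =>
        rw [← sub_add_sub_cancel (u (n + 1)) (u n) x]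
        exact norm_add_le_of_le ((hd n).trans
          (mul_le_of_le_one_right hr0 (pow_le_one₀ hr0 hr.le))) ih
    exact le_of_tendsto (hy.sub_const x).norm (Filter.Eventually.of_forall h1)

/-- Coefficients of a polynomial are bounded by its values at points with distance one. -/
theorem norm_coeff_le_of_norm_eval_le {δ : ℝ} (hδ : 0 ≤ δ) (T : Finset L)
    (hT : ∀ x ∈ T, ‖x‖ ≤ 1) (hTT : ∀ x ∈ T, ∀ y ∈ T, x ≠ y → ‖x - y‖ = 1)
    (P : Polynomial L) (hP : P.natDegree < T.card) (hPT : ∀ x ∈ T, ‖P.eval x‖ ≤ δ) (n : ℕ) :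
    ‖P.coeff n‖ ≤ δ := by
  classical
  induction T using Finset.induction_on generalizing P n with
  | empty => simp at hP
  | insert a T ha ih =>
    rw [Finset.card_insert_of_notMem ha] at hP
    have hPa := hPT a (Finset.mem_insert_self _ _)
    rcases T.eq_empty_or_nonempty with rfl | hne
    · rw [Polynomial.eq_C_of_natDegree_le_zero (p := P) (by simpa using hP)] at hPa ⊢
      rw [Polynomial.eval_C] at hPa
      rw [Polynomial.coeff_C]
      split_ifs
      · exact hPa
      · simpa using hδ
    -- Newton interpolation: the values of `Q` on `T` are difference quotients of `P` with
    -- denominators of norm one, so they satisfy the same bound.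
    · set Q := P /ₘ (Polynomial.X - Polynomial.C a) with hQ
      have hdec : P = Polynomial.C (P.eval a) + (Polynomial.X - Polynomial.C a) * Q := by
        rw [← Polynomial.modByMonic_X_sub_C_eq_C_eval, Polynomial.modByMonic_add_div]
      have hQc : ∀ n, ‖Q.coeff n‖ ≤ δ := by
        refine ih (fun x hx => hT x (Finset.mem_insert_of_mem hx))
          (fun x hx y hy => hTT x (Finset.mem_insert_of_mem hx) y (Finset.mem_insert_of_mem hy))
          Q ?_ ?_
        · rw [hQ, Polynomial.natDegree_divByMonic _ (Polynomial.monic_X_sub_C a),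
            Polynomial.natDegree_X_sub_C]
          have := hne.card_pos
          omega
        · intro x hx
          have hxa : x ≠ a := fun h => ha (h ▸ hx)
          have h1 : P.eval x - P.eval a = (x - a) * Q.eval x := by
            conv_lhs => rw [hdec]
            simp
          have h2 := norm_sub_le_of_le (hPT x (Finset.mem_insert_of_mem hx)) hPa
          rwa [h1, norm_mul, hTT x (Finset.mem_insert_of_mem hx) a (Finset.mem_insert_self _ _) hxa,
            one_mul] at h2
      have haQ : ∀ n, ‖a * Q.coeff n‖ ≤ δ := fun n => by
        rw [norm_mul]
        exact (mul_le_of_le_one_left (norm_nonneg _) (hT a (Finset.mem_insert_self _ _))).trans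
          (hQc n)
      rw [hdec, sub_mul]
      cases n with
      | zero => simpa [sub_eq_add_neg] using norm_sub_le_of_le hPa (haQ 0)
      | succ n => simpa [Polynomial.coeff_C] using norm_sub_le_of_le (hQc n) (haQ (n + 1))

end Teichmuller

/-- There are at most `finrank` embeddings of `K` into `L`, and the composites of `i` with powers of
the Frobenius already supply that many. -/
theorem exists_pow_eq_of_finite_field {p : ℕ} [Fact p.Prime] {K L : Type*} [Field K] [Finite K]
    [Field L] [Algebra (ZMod p) K] [Algebra (ZMod p) L] (s i : K →ₐ[ZMod p] L) :
    ∃ n < Module.finrank (ZMod p) K, ∀ x, s x = i x ^ p ^ n := by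
  have hinj : Function.Injective fun n : Fin (Module.finrank (ZMod p) K) =>
      i.comp (FiniteField.frobeniusAlgHom (ZMod p) K ^ n.1) := by
    intro m n h
    apply (FiniteField.bijective_frobeniusAlgHom_pow (ZMod p) K).1
    ext x
    exact i.injective (DFunLike.congr_fun h x)
  have hbij := hinj.bijective_of_nat_card_le
    ((card_algHom_le_finrank (ZMod p) K L).trans_eq (by simp))
  obtain ⟨n, hn⟩ := hbij.2 s
  refine ⟨n, n.2, fun x => ?_⟩
  rw [← hn]
  simp [AlgHom.coe_pow, FiniteField.coe_frobeniusAlgHom, pow_iterate, ZMod.card]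

/-- Each index owns the block of base-`p` digits from `pos a` up to `pos a + gap a`, and the blocks
do not overlap. The two claims go together: the bound on the lower blocks is what allows the top one
to be read off by division by `p ^ pos m`. -/
theorem mixedRadix_sum_lt {ι : Type*} (s : Finset ι) (pos gap : ι → ℕ) {p : ℕ}
    (hp : 0 < p) (h : ∀ a ∈ s, ∀ b ∈ s, a ≠ b → pos a ≤ pos b → pos a + gap a ≤ pos b) :
    (∀ B, (∀ a ∈ s, pos a + gap a ≤ B) → ∀ i : ι → ℕ, (∀ a ∈ s, i a < p ^ gap a) →
      ∑ a ∈ s, p ^ pos a * i a < p ^ B) ∧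
    ∀ i j : ι → ℕ, (∀ a ∈ s, i a < p ^ gap a) → (∀ a ∈ s, j a < p ^ gap a) →
      ∑ a ∈ s, p ^ pos a * i a = ∑ a ∈ s, p ^ pos a * j a → ∀ a ∈ s, i a = j a := by
  classical
  induction s using Finset.induction_on_max_value pos with
  | empty => exact ⟨fun B _ i _ => by simpa using pow_pos hp B, by simp⟩
  | insert m s hm hmax ih =>
    obtain ⟨ih1, ih2⟩ := ih fun a ha b hb =>
      h a (Finset.mem_insert_of_mem ha) b (Finset.mem_insert_of_mem hb)
    have hlt : ∀ i : ι → ℕ, (∀ a ∈ insert m s, i a < p ^ gap a) →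
        ∑ a ∈ s, p ^ pos a * i a < p ^ pos m := fun i hi =>
      ih1 (pos m) (fun a ha => h a (Finset.mem_insert_of_mem ha) m (Finset.mem_insert_self _ _)
        (fun hh => hm (hh ▸ ha)) (hmax a ha)) i fun a ha => hi a (Finset.mem_insert_of_mem ha)
    constructor
    · intro B hB i hi
      rw [Finset.sum_insert hm]
      have h1 := hlt i hi
      have h2 := hi m (Finset.mem_insert_self _ _)
      calc p ^ pos m * i m + ∑ a ∈ s, p ^ pos a * i a
          < p ^ pos m * i m + p ^ pos m := by omega
        _ = p ^ pos m * (i m + 1) := by ring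
        _ ≤ p ^ pos m * p ^ gap m := Nat.mul_le_mul_left _ h2
        _ = p ^ (pos m + gap m) := (pow_add _ _ _).symm
        _ ≤ p ^ B := Nat.pow_le_pow_right hp (hB m (Finset.mem_insert_self _ _))
    · intro i j hi hj hij
      rw [Finset.sum_insert hm, Finset.sum_insert hm] at hij
      have h1 := hlt i hi
      have h2 := hlt j hj
      have h3 : i m = j m := by
        have h4 := congrArg (· / p ^ pos m) hij
        simpa [Nat.mul_add_div (pow_pos hp (pos m)), Nat.div_eq_of_lt h1, Nat.div_eq_of_lt h2]
          using h4
      rw [h3, add_right_inj] at hij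
      intro a ha
      rcases Finset.mem_insert.1 ha with rfl | ha
      · exact h3
      · exact ih2 i j (fun a ha => hi a (Finset.mem_insert_of_mem ha))
          (fun a ha => hj a (Finset.mem_insert_of_mem ha)) hij a ha

/-! ### Teichmüller representatives in local fields, and the arithmetic estimate -/

section LocalFields

variable {p : ℕ} [Fact p.Prime]
variable {F : Type*} [NormedField F] [IsUltrametricDist F] [NormedAlgebra ℚ_[p] F]
variable {E : Type*} [NormedField E] [IsUltrametricDist E] [NormedAlgebra ℚ_[p] E]

omit [IsUltrametricDist F] in
theorem norm_natCast_prime_lt_one : ‖(p : F)‖ < 1 := by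
  have h := norm_algebraMap' F (p : ℚ_[p])
  rw [map_natCast] at h
  rw [h]
  exact Padic.norm_p_lt_one

omit [IsUltrametricDist F] in
theorem natCast_prime_ne_zero : (p : F) ≠ 0 := by
  have : CharZero F := charZero_of_injective_algebraMap (algebraMap ℚ_[p] F).injective
  exact_mod_cast (Fact.out : p.Prime).ne_zero

omit [IsUltrametricDist F] in
theorem norm_natCast_prime_pow_lt_one {f : ℕ} (hf : f ≠ 0) : ‖((p ^ f : ℕ) : F)‖ < 1 := by
  rw [Nat.cast_pow, norm_pow]
  exact pow_lt_one₀ (norm_nonneg _) norm_natCast_prime_lt_one hf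

variable (p F) in
theorem charP_residueField : CharP (IsLocalRing.ResidueField (integers F)) p := by
  rw [CharP.charP_iff_prime_eq_zero Fact.out, ← map_natCast (IsLocalRing.residue (integers F)),
    IsLocalRing.residue_eq_zero_iff, mem_maximalIdeal_iff]
  simpa using norm_natCast_prime_lt_one (p := p) (F := F)

omit [Fact p.Prime] [NormedAlgebra ℚ_[p] F] in
theorem ne_zero_of_card_residueField {f : ℕ}
    (hf : Nat.card (IsLocalRing.ResidueField (integers F)) = p ^ f) : f ≠ 0 := by
  rintro rfl
  rw [pow_zero] at hf
  have := (Nat.card_eq_one_iff_unique.1 hf).1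
  exact not_subsingleton (IsLocalRing.ResidueField (integers F)) this

variable [FiniteDimensional ℚ_[p] F]

/-- The homomorphism between the rings of integers given by an embedding. -/
def integersMap (σ : F →ₐ[ℚ_[p]] E) : integers F →+* integers E :=
  RingHom.codRestrict ((σ : F →+* E).comp (integers F).subtype) (integers E) fun x =>
    mem_integers.2 ((norm_algHom_le σ x).trans (mem_integers.1 x.2))

theorem coe_integersMap (σ : F →ₐ[ℚ_[p]] E) (x : integers F) :
    (integersMap σ x : E) = σ x := rfl

instance (σ : F →ₐ[ℚ_[p]] E) : IsLocalHom (integersMap σ) where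
  map_nonunit x hx := by
    by_contra h
    have h1 : x ∈ IsLocalRing.maximalIdeal (integers F) := h
    rw [mem_maximalIdeal_iff, ← norm_algHom σ, ← coe_integersMap, ← mem_maximalIdeal_iff] at h1
    exact h1 hx

/-- On Teichmüller representatives, two embeddings differ by a power of the Frobenius. -/
theorem exists_eq_pow_on_teichmullerSet {f : ℕ}
    (hf : Nat.card (IsLocalRing.ResidueField (integers F)) = p ^ f) (σ ι : F →ₐ[ℚ_[p]] E) :
    ∃ l < f, ∀ x ∈ teichmullerSet F (p ^ f), σ x = ι x ^ p ^ l := by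
  have hp : p.Prime := Fact.out
  have hf0 := ne_zero_of_card_residueField hf
  have := charP_residueField p F
  have := charP_residueField p E
  have := finite_residueField p F
  let := ZMod.algebra (IsLocalRing.ResidueField (integers F)) p
  let := ZMod.algebra (IsLocalRing.ResidueField (integers E)) p
  let r : (F →ₐ[ℚ_[p]] E) →
      (IsLocalRing.ResidueField (integers F) →ₐ[ZMod p] IsLocalRing.ResidueField (integers E)) :=
    fun σ => { IsLocalRing.ResidueField.map (integersMap σ) with
      commutes' := fun x => RingHom.congr_fun (Subsingleton.elim
        ((IsLocalRing.ResidueField.map (integersMap σ)).comp (algebraMap (ZMod p) _))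
        (algebraMap (ZMod p) _)) x }
  have hr : ∀ σ x, r σ (IsLocalRing.residue _ x) = IsLocalRing.residue _ (integersMap σ x) :=
    fun _ _ => rfl
  obtain ⟨n, hn, h⟩ := exists_pow_eq_of_finite_field (r σ) (r ι)
  refine ⟨n, ?_, fun x hx => ?_⟩
  · have h1 : Module.finrank (ZMod p) (IsLocalRing.ResidueField (integers F)) = f := by
      have h2 := Module.natCard_eq_pow_finrank (K := ZMod p)
        (V := IsLocalRing.ResidueField (integers F))
      rw [hf, Nat.card_zmod] at h2
      exact (Nat.pow_right_injective hp.two_le h2).symm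
    rwa [h1] at hn
  · have hq1 : 1 < p ^ f := Nat.one_lt_pow hf0 hp.one_lt
    have hx' : x ^ p ^ f = x := hx
    -- Both sides are roots of `X ^ q - X`, so it is enough that they are congruent modulo the
    -- maximal ideal.
    refine teichmullerSet_eq_of_norm_sub_lt hq1 (norm_natCast_prime_pow_lt_one hf0)
      (show σ x ^ p ^ f = σ x by rw [← map_pow, hx'])
      (show (ι x ^ p ^ n) ^ p ^ f = ι x ^ p ^ n by
        rw [← pow_mul, mul_comm, pow_mul, ← map_pow, hx']) ?_
    have hx1 : x ∈ integers F := mem_integers.2 (teichmullerSet_norm_le hq1 hx)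
    have h1 := h (IsLocalRing.residue _ ⟨x, hx1⟩)
    rw [hr, hr, ← map_pow, ← sub_eq_zero, ← map_sub, IsLocalRing.residue_eq_zero_iff,
      mem_maximalIdeal_iff] at h1
    exact h1

theorem exists_finset_teichmullerSet {f : ℕ}
    (hf : Nat.card (IsLocalRing.ResidueField (integers F)) = p ^ f) {ϖ : integers F}
    (hϖ : IsUniformizer ϖ) :
    ∃ T : Finset F, T.card = p ^ f ∧ (∀ x ∈ T, x ∈ teichmullerSet F (p ^ f) ∧ ‖x‖ ≤ 1) ∧
      ∀ x ∈ T, ∀ y ∈ T, x ≠ y → ‖x - y‖ = 1 := by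
  classical
  have hp : p.Prime := Fact.out
  have hf0 := ne_zero_of_card_residueField hf
  have hq1 : 1 < p ^ f := Nat.one_lt_pow hf0 hp.one_lt
  have hfin := finite_residueField p F
  have := FiniteDimensional.complete ℚ_[p] F
  let := Fintype.ofFinite (IsLocalRing.ResidueField (integers F))
  have hex : ∀ y : IsLocalRing.ResidueField (integers F), ∃ x : integers F,
      (x : F) ∈ teichmullerSet F (p ^ f) ∧ IsLocalRing.residue _ x = y := by
    intro y
    obtain ⟨x, rfl⟩ := IsLocalRing.residue_surjective y
    have h1 : ‖((x ^ p ^ f - x : integers F) : F)‖ < 1 := by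
      rw [← mem_maximalIdeal_iff, ← IsLocalRing.residue_eq_zero_iff, map_sub, map_pow, ← hf,
        Nat.card_eq_fintype_card, FiniteField.pow_card, sub_self]
    obtain ⟨z, hz, hzx⟩ := exists_teichmuller hϖ.norm_lt_one
      (hϖ.norm_le (norm_natCast_prime_pow_lt_one hf0)) (mem_integers.1 x.2)
      (hϖ.norm_le h1)
    refine ⟨⟨z, mem_integers.2 (teichmullerSet_norm_le hq1 hz)⟩, hz, ?_⟩
    rw [← sub_eq_zero, ← map_sub, IsLocalRing.residue_eq_zero_iff, mem_maximalIdeal_iff]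
    exact hzx.trans_lt hϖ.norm_lt_one
  choose t ht1 ht2 using hex
  have hinj : Function.Injective fun y => (t y : F) := fun y z hyz => by
    rw [← ht2 y, ← ht2 z, Subtype.ext hyz]
  refine ⟨Finset.univ.image fun y => (t y : F), ?_, ?_, ?_⟩
  · rw [Finset.card_image_of_injective _ hinj, Finset.card_univ, ← Nat.card_eq_fintype_card, hf]
  · intro x hx
    obtain ⟨y, -, rfl⟩ := Finset.mem_image.1 hx
    exact ⟨ht1 y, mem_integers.1 (t y).2⟩
  · intro x hx x' hx' hne
    obtain ⟨y, -, rfl⟩ := Finset.mem_image.1 hx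
    obtain ⟨z, -, rfl⟩ := Finset.mem_image.1 hx'
    refine le_antisymm (norm_sub_le_of_le (mem_integers.1 (t y).2) (mem_integers.1 (t z).2)) ?_
    by_contra! hlt
    refine hne ?_
    have h1 : t y - t z ∈ IsLocalRing.maximalIdeal (integers F) := mem_maximalIdeal_iff.2 hlt
    rw [← IsLocalRing.residue_eq_zero_iff, map_sub, sub_eq_zero, ht2, ht2] at h1
    rw [h1]

/-- For Teichmüller `μ` the sum is a polynomial in `τ μ`, for a suitable embedding `τ`, and the
conditions on `d` make its exponents distinct and smaller than `p ^ f`. Interpolation at the `p ^ f`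
Teichmüller points then bounds each coefficient. -/
theorem norm_le_of_forall_norm_sum_le {f : ℕ}
    (hf : Nat.card (IsLocalRing.ResidueField (integers F)) = p ^ f) {ϖ : integers F}
    (hϖ : IsUniformizer ϖ) (ι : F →ₐ[ℚ_[p]] E) {d : (F →ₐ[ℚ_[p]] E) → ℕ}
    (hd₁ : ∀ l < f, (J f ι d l).ncard ≤ 1)
    (hd₂ : ∀ l < f, ∀ σ ∈ J f ι d l, d σ + 1 ≤ p ^ gap f ι d l)
    [Fintype (F →ₐ[ℚ_[p]] E)] [DecidableEq (F →ₐ[ℚ_[p]] E)]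
    (c : ((σ : F →ₐ[ℚ_[p]] E) → Fin (d σ + 1)) → E) {δ : ℝ} (hδ : 0 ≤ δ)
    (hc : ∀ μ : F, ‖μ‖ ≤ 1 → ‖∑ i, c i * ∏ σ, σ μ ^ (i σ : ℕ)‖ ≤ δ)
    (i : (σ : F →ₐ[ℚ_[p]] E) → Fin (d σ + 1)) : ‖c i‖ ≤ δ := by
  have hp : p.Prime := Fact.out
  choose l hlf hl using fun σ => exists_eq_pow_on_teichmullerSet hf σ ι
  let s : Finset (F →ₐ[ℚ_[p]] E) := Finset.univ.filter fun σ => d σ ≠ 0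
  have hs : ∀ σ, σ ∈ s ↔ d σ ≠ 0 := by simp [s]
  have hi0 : ∀ (i : (σ : F →ₐ[ℚ_[p]] E) → Fin (d σ + 1)) (σ), σ ∉ s → (i σ : ℕ) = 0 := by
    intro i σ hσ
    have h1 := (i σ).2
    have h2 : d σ = 0 := by simpa [hs] using hσ
    omega
  have hJ : ∀ σ ∈ s, σ ∈ J f ι d (l σ) := fun σ hσ => ⟨(hs σ).1 hσ, hl σ⟩
  rcases s.eq_empty_or_nonempty with hse | hne
  · have hsub : ∀ j : (σ : F →ₐ[ℚ_[p]] E) → Fin (d σ + 1), j = i := by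
      intro j
      ext σ
      rw [hi0 j σ (by simp [hse]), hi0 i σ (by simp [hse])]
    -- All `d σ` vanish here: there is a single index and an empty monomial, so any `μ` returns the
    -- coefficient.
    have h1 := hc 0 (by simp)
    rw [Finset.sum_eq_single i (fun j _ hj => absurd (hsub j) hj) (by simp),
      Finset.prod_eq_one (fun σ _ => by rw [hi0 i σ (by simp [hse]), pow_zero]), mul_one] at h1
    exact h1
  -- The variable is `τ μ`, with least Frobenius exponent, rather than `ι μ`: this divides all
  -- exponents by `p ^ l τ`. In terms of `ι μ` they would only be below `p ^ (l τ + f)`, too large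
  -- for interpolation at `p ^ f` points.
  obtain ⟨τ, hτ, hmin⟩ := s.exists_min_image l hne
  have hgap : ∀ a ∈ s, ∀ b ∈ s, a ≠ b → l a ≤ l b → l a + gap f ι d (l a) ≤ l b := by
    intro a ha b hb hab hle
    have hlt : l a ≠ l b := fun h => hab
      ((Set.ncard_le_one (Set.toFinite _)).1 (hd₁ (l a) (hlf a)) a (hJ a ha) b (h ▸ hJ b hb))
    have h1 : gap f ι d (l a) ≤ l b - l a := Nat.sInf_le ⟨by omega, by have := hlf b; omega, by
      rw [show l a + (l b - l a) = l b by omega, Nat.mod_eq_of_lt (hlf b)]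
      exact ⟨b, hJ b hb⟩⟩
    omega
  -- The gap is cyclic: going around modulo `f` one meets `τ` again, so even the last block of
  -- digits ends by `l τ + f`.
  have hgap' : ∀ a ∈ s, l a + gap f ι d (l a) ≤ l τ + f := by
    intro a ha
    have h0 := hmin a ha
    have h2 := hlf a
    have h1 : gap f ι d (l a) ≤ l τ + f - l a := Nat.sInf_le ⟨by omega, by omega, by
      rw [show l a + (l τ + f - l a) = l τ + f by omega, Nat.add_mod_right,
        Nat.mod_eq_of_lt (hlf τ)]
      exact ⟨τ, hJ τ hτ⟩⟩
    omega
  obtain ⟨hbound, hinj⟩ := mixedRadix_sum_lt s (fun σ => l σ - l τ) (fun σ => gap f ι d (l σ))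
    hp.pos fun a ha b hb hab hle => by
      have h0 := hmin a ha
      have h1 := hmin b hb
      have h2 := hgap a ha b hb hab (by omega)
      omega
  have hlt : ∀ (i : (σ : F →ₐ[ℚ_[p]] E) → Fin (d σ + 1)), ∀ σ ∈ s,
      (i σ : ℕ) < p ^ gap f ι d (l σ) := fun i σ hσ =>
    (i σ).2.trans_le (hd₂ (l σ) (hlf σ) σ (hJ σ hσ))
  let e : ((σ : F →ₐ[ℚ_[p]] E) → Fin (d σ + 1)) → ℕ := fun i =>
    ∑ σ ∈ s, p ^ (l σ - l τ) * (i σ : ℕ)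
  have he : ∀ i, e i < p ^ f := fun i => hbound f (fun a ha => by
    have h0 := hmin a ha
    have h1 := hgap' a ha
    omega) (fun σ => i σ) (hlt i)
  have heinj : Function.Injective e := by
    intro i j hij
    ext σ
    by_cases hσ : σ ∈ s
    · exact hinj (fun σ => i σ) (fun σ => j σ) (hlt i) (hlt j) hij σ hσ
    · rw [hi0 i σ hσ, hi0 j σ hσ]
  let P : Polynomial E := ∑ i, Polynomial.C (c i) * Polynomial.X ^ e i
  obtain ⟨T, hTc, hT1, hT2⟩ := exists_finset_teichmullerSet hf hϖ
  have hcard : (T.map ⟨τ, τ.injective⟩).card = p ^ f := by rw [Finset.card_map, hTc]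
  have key := norm_coeff_le_of_norm_eval_le hδ (T.map ⟨τ, τ.injective⟩)
    (by
      intro x hx
      obtain ⟨y, hy, rfl⟩ := Finset.mem_map.1 hx
      exact (norm_algHom_le τ y).trans (hT1 y hy).2)
    (by
      intro x hx x' hx' hne'
      obtain ⟨y, hy, rfl⟩ := Finset.mem_map.1 hx
      obtain ⟨y', hy', rfl⟩ := Finset.mem_map.1 hx'
      change ‖τ y - τ y'‖ = 1
      rw [← map_sub, norm_algHom]
      exact hT2 y hy y' hy' fun h => hne' (by rw [h]))
    P (by
      rw [hcard]
      have h1 : P.natDegree ≤ p ^ f - 1 := Polynomial.natDegree_sum_le_of_forall_le _ _ fun i _ =>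
        (Polynomial.natDegree_C_mul_X_pow_le _ _).trans (by have := he i; omega)
      have := pow_pos hp.pos f
      omega)
    (by
      intro x hx
      obtain ⟨μ, hμ, rfl⟩ := Finset.mem_map.1 hx
      convert hc μ (hT1 μ hμ).2 using 2
      simp only [P, Polynomial.eval_finsetSum, Polynomial.eval_mul, Polynomial.eval_C,
        Polynomial.eval_pow, Polynomial.eval_X, Function.Embedding.coeFn_mk]
      refine Finset.sum_congr rfl fun i _ => ?_
      congr 1
      rw [← Finset.prod_subset (Finset.subset_univ s) fun σ _ hσ => by
        rw [hi0 i σ hσ, pow_zero]]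
      rw [← Finset.prod_pow_eq_pow_sum]
      refine Finset.prod_congr rfl fun σ hσ => ?_
      rw [pow_mul, hl τ μ (hT1 μ hμ).1, hl σ μ (hT1 μ hμ).1, ← pow_mul (ι μ), ← pow_add,
        Nat.add_sub_cancel' (hmin σ hσ)])
    (e i)
  have hco : P.coeff (e i) = c i := by
    simp only [P, Polynomial.finsetSum_coeff, Polynomial.coeff_C_mul_X_pow]
    rw [Finset.sum_eq_single i (fun j _ hj => if_neg fun h => hj (heinj h.symm)) (by simp),
      if_pos rfl]
  rwa [hco] at key

end LocalFields

/-! ### Coordinates on the spaces of homogeneous polynomials -/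

section SymBasis

variable {E : Type*} [Field E]

/-- The exponent of the monomial `x ^ (n - i) * y ^ i`. -/
def symExponent (n : ℕ) (i : Fin (n + 1)) : Fin 2 →₀ ℕ :=
  Finsupp.single 0 (n - (i : ℕ)) + Finsupp.single 1 (i : ℕ)

theorem symExponent_injective (n : ℕ) : Function.Injective (symExponent n) := fun i j h => by
  have := DFunLike.congr_fun h 1
  simpa [symExponent, Fin.ext_iff] using this

theorem symMonomial_val (n : ℕ) (i : Fin (n + 1)) :
    (symMonomial E n i).1 = MvPolynomial.monomial (symExponent n i) 1 := by
  simp [symMonomial, symExponent, MvPolynomial.X_pow_eq_monomial, MvPolynomial.monomial_mul]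

theorem symExponent_surjective {n : ℕ} {e : Fin 2 →₀ ℕ} (he : e.degree = n) :
    ∃ i, symExponent n i = e := by
  rw [Finsupp.degree_eq_sum, Fin.sum_univ_two] at he
  refine ⟨⟨e 1, by omega⟩, ?_⟩
  ext j
  fin_cases j
  · simp [symExponent]
    omega
  · simp [symExponent]

theorem sum_coeff_smul_symMonomial (n : ℕ) (P : Sym E n) :
    ∑ i, P.1.coeff (symExponent n i) • symMonomial E n i = P := by
  ext e
  simp only [Submodule.coe_sum, Submodule.coe_smul, symMonomial_val, MvPolynomial.coeff_sum,
    MvPolynomial.coeff_smul, MvPolynomial.coeff_monomial, smul_eq_mul, mul_ite, mul_one, mul_zero]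
  by_cases he : e.degree = n
  · obtain ⟨i, rfl⟩ := symExponent_surjective he
    simp [(symExponent_injective n).eq_iff]
  · have hP := (MvPolynomial.mem_homogeneousSubmodule n P.1).1 P.2
    rw [hP.coeff_eq_zero he]
    refine Finset.sum_eq_zero fun i _ => ?_
    split_ifs with h
    · rw [h, hP.coeff_eq_zero he]
    · rfl

variable (E) in
/-- The basis of the space of homogeneous polynomials given by the monomials. -/
def symBasis (n : ℕ) : Module.Basis (Fin (n + 1)) E (Sym E n) :=
  .ofEquivFun
    { toFun := fun P i => P.1.coeff (symExponent n i)
      map_add' := fun P Q => by ext i; simp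
      map_smul' := fun c P => by ext i; simp
      invFun := fun c => ∑ i, c i • symMonomial E n i
      left_inv := sum_coeff_smul_symMonomial n
      right_inv := fun c => by
        ext i
        simp only [Submodule.coe_sum, Submodule.coe_smul, symMonomial_val,
          MvPolynomial.coeff_sum, MvPolynomial.coeff_smul, MvPolynomial.coeff_monomial,
          smul_eq_mul, mul_ite, mul_one, mul_zero]
        simp [(symExponent_injective n).eq_iff] }

theorem symBasis_repr (n : ℕ) (P : Sym E n) (i : Fin (n + 1)) :
    (symBasis E n).repr P i = P.1.coeff (symExponent n i) := rfl

theorem symBasis_apply (n : ℕ) (i : Fin (n + 1)) : symBasis E n i = symMonomial E n i := by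
  apply (symBasis E n).repr.injective
  ext j
  rw [Module.Basis.repr_self, symBasis_repr, symMonomial_val, MvPolynomial.coeff_monomial,
    Finsupp.single_apply]
  simp [(symExponent_injective n).eq_iff]

theorem symBasis_repr_zero (n : ℕ) (P : Sym E n) :
    (symBasis E n).repr P 0 = MvPolynomial.eval ![1, 0] P.1 := by
  conv_rhs => rw [← sum_coeff_smul_symMonomial n P]
  simp only [Submodule.coe_sum, Submodule.coe_smul, map_sum, MvPolynomial.smul_eval, symMonomial,
    map_mul, map_pow, MvPolynomial.eval_X]
  rw [Finset.sum_eq_single 0 (fun i _ hi => by simp [Fin.val_ne_zero_iff.2 hi]) (by simp)]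
  simp [symBasis_repr]

theorem symAction_symMonomial (n : ℕ) (m : Matrix (Fin 2) (Fin 2) E) (i : Fin (n + 1)) :
    (symAction E n m (symMonomial E n i)).1
      = (∑ k, MvPolynomial.C (m k 0) * MvPolynomial.X k) ^ (n - (i : ℕ)) *
        (∑ k, MvPolynomial.C (m k 1) * MvPolynomial.X k) ^ (i : ℕ) := by
  change substHom m (symMonomial E n i).1 = _
  simp [symMonomial, substHom]

/-- The coefficient of `x ^ n` is the value at `(1, 0)`, so only the top row of `m` enters. It is
the one coordinate that the descent on the tree exploits. -/
theorem symBasis_repr_symAction_zero (n : ℕ) (m : Matrix (Fin 2) (Fin 2) E) (i : Fin (n + 1)) :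
    (symBasis E n).repr (symAction E n m (symMonomial E n i)) 0
      = m 0 0 ^ (n - (i : ℕ)) * m 0 1 ^ (i : ℕ) := by
  rw [symBasis_repr_zero, symAction_symMonomial]
  simp [Fin.sum_univ_two]

end SymBasis

theorem norm_symBasis_repr_symAction_le {E : Type*} [NormedField E] [IsUltrametricDist E] (n : ℕ)
    (m : Matrix (Fin 2) (Fin 2) E) (hm : ∀ i j, ‖m i j‖ ≤ 1) (i j : Fin (n + 1)) :
    ‖(symBasis E n).repr (symAction E n m (symMonomial E n i)) j‖ ≤ 1 := by
  let m' : Matrix (Fin 2) (Fin 2) (integers E) := fun i j => ⟨m i j, mem_integers.2 (hm i j)⟩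
  have h : (symAction E n m (symMonomial E n i)).1 = MvPolynomial.map (integers E).subtype
      ((∑ k, MvPolynomial.C (m' k 0) * MvPolynomial.X k) ^ (n - (i : ℕ)) *
        (∑ k, MvPolynomial.C (m' k 1) * MvPolynomial.X k) ^ (i : ℕ)) := by
    rw [symAction_symMonomial]
    simp [m']
  rw [symBasis_repr, h, MvPolynomial.coeff_map]
  exact mem_integers.1 (SetLike.coe_mem _)

/-! ### Coordinates on the space of `ρ_d` -/

section RhoBasis

variable {p : ℕ} [Fact p.Prime]
variable {F : Type*} [NormedField F] [IsUltrametricDist F] [NormedAlgebra ℚ_[p] F]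
  [FiniteDimensional ℚ_[p] F]
variable {E : Type*} [NormedField E] [IsUltrametricDist E] [NormedAlgebra ℚ_[p] E]

instance fintypeEmbeddings : Fintype (F →ₐ[ℚ_[p]] E) := Fintype.ofFinite _

/-- The basis of the space of `ρ_d` given by the vectors `e_{d,i}`. -/
def rhoBasis (d : (F →ₐ[ℚ_[p]] E) → ℕ) :
    Module.Basis ((σ : F →ₐ[ℚ_[p]] E) → Fin (d σ + 1)) E (RhoSpace d) :=
  Basis.piTensorProduct fun σ => symBasis E (d σ)

theorem rhoBasis_apply (d : (F →ₐ[ℚ_[p]] E) → ℕ) (i) : rhoBasis d i = rhoMonomial d i := by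
  refine (Basis.piTensorProduct_apply _ i).trans ?_
  simp only [symBasis_apply]
  rfl

theorem rhoBasis_repr_rhoMap (d : (F →ₐ[ℚ_[p]] E) → ℕ)
    (u : (σ : F →ₐ[ℚ_[p]] E) → Module.End E (Sym E (d σ))) (i j) :
    (rhoBasis d).repr (rhoMap d u (rhoMonomial d i)) j
      = ∏ σ, (symBasis E (d σ)).repr (u σ (symMonomial E (d σ) (i σ))) (j σ) := by
  have h : rhoMap d u (rhoMonomial d i)
      = PiTensorProduct.tprod E fun σ => u σ (symMonomial E (d σ) (i σ)) :=
    PiTensorProduct.map_tprod _ _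
  rw [h]
  exact Basis.piTensorProduct_repr_tprod_apply _ _ _

theorem rhoBasis_repr_apply [DecidableEq (F →ₐ[ℚ_[p]] E)] (d : (F →ₐ[ℚ_[p]] E) → ℕ)
    (A : Module.End E (RhoSpace d)) (v : RhoSpace d) (j) :
    (rhoBasis d).repr (A v) j
      = ∑ i, (rhoBasis d).repr v i * (rhoBasis d).repr (A (rhoMonomial d i)) j := by
  conv_lhs => rw [← (rhoBasis d).sum_repr v]
  simp [rhoBasis_apply]

/-- The vectors of the space of `ρ_d` with coordinates of norm at most `δ`. -/
def rhoBall (d : (F →ₐ[ℚ_[p]] E) → ℕ) (δ : NNReal) : Submodule (integers E) (RhoSpace d) where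
  carrier := {v | ∀ i, ‖(rhoBasis d).repr v i‖ ≤ δ}
  zero_mem' i := by simp
  add_mem' hv hw i := by
    rw [map_add, Finsupp.add_apply]
    exact norm_add_le_of_le (hv i) (hw i)
  smul_mem' c v hv i := by
    change ‖(rhoBasis d).repr ((c : E) • v) i‖ ≤ δ
    rw [map_smul, Finsupp.smul_apply, smul_eq_mul, norm_mul]
    exact (mul_le_of_le_one_left (norm_nonneg _) (mem_integers.1 c.2)).trans (hv i)

theorem mem_rhoBall {d : (F →ₐ[ℚ_[p]] E) → ℕ} {δ : NNReal} {v : RhoSpace d} :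
    v ∈ rhoBall d δ ↔ ∀ i, ‖(rhoBasis d).repr v i‖ ≤ δ := Iff.rfl

theorem rhoIntegral_eq (d : (F →ₐ[ℚ_[p]] E) → ℕ) : rhoIntegral d = rhoBall d 1 := by
  classical
  apply le_antisymm
  · refine Submodule.span_le.2 ?_
    rintro _ ⟨i, rfl⟩ j
    rw [← rhoBasis_apply, Module.Basis.repr_self, Finsupp.single_apply]
    split_ifs <;> simp
  · intro v hv
    rw [← (rhoBasis d).sum_repr v]
    refine Submodule.sum_mem _ fun i _ => ?_
    rw [rhoBasis_apply]
    exact Submodule.smul_mem _ (⟨_, mem_integers.2 (hv i)⟩ : integers E)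
      (Submodule.subset_span ⟨i, rfl⟩)

theorem exists_mem_rhoBall {d : (F →ₐ[ℚ_[p]] E) → ℕ} (v : RhoSpace d) :
    ∃ δ, v ∈ rhoBall d δ := by
  classical
  refine ⟨∑ i, ‖(rhoBasis d).repr v i‖₊, fun i => ?_⟩
  rw [← coe_nnnorm, NNReal.coe_le_coe]
  exact Finset.single_le_sum (f := fun i => ‖(rhoBasis d).repr v i‖₊) (fun _ _ => zero_le)
    (Finset.mem_univ i)

/-- An endomorphism of the space of `ρ_d` whose matrix has integral entries. -/
def IsIntegralEnd {d : (F →ₐ[ℚ_[p]] E) → ℕ} (A : Module.End E (RhoSpace d)) : Prop :=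
  ∀ i j, ‖(rhoBasis d).repr (A (rhoMonomial d i)) j‖ ≤ 1

theorem IsIntegralEnd.apply_mem {d : (F →ₐ[ℚ_[p]] E) → ℕ} {A : Module.End E (RhoSpace d)}
    (hA : IsIntegralEnd A) {δ : NNReal} {v : RhoSpace d} (hv : v ∈ rhoBall d δ) :
    A v ∈ rhoBall d δ := by
  classical
  intro j
  rw [rhoBasis_repr_apply]
  refine IsUltrametricDist.norm_sum_le_of_forall_le_of_nonneg δ.2 fun i _ => ?_
  rw [norm_mul]
  exact (mul_le_of_le_one_right (norm_nonneg _) (hA i j)).trans (hv i)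

theorem isIntegralEnd_rhoMap {d : (F →ₐ[ℚ_[p]] E) → ℕ}
    {u : (σ : F →ₐ[ℚ_[p]] E) → Module.End E (Sym E (d σ))}
    (hu : ∀ σ i j, ‖(symBasis E (d σ)).repr (u σ (symMonomial E (d σ) i)) j‖ ≤ 1) :
    IsIntegralEnd (rhoMap d u) := by
  intro i j
  rw [rhoBasis_repr_rhoMap, norm_prod]
  exact Finset.prod_le_one (fun _ _ => norm_nonneg _) fun σ _ => hu σ _ _

end RhoBasis

/-! ### Integrality of the action of `KZ` -/

theorem mem_KZ_iff {F : Type*} [NormedField F] [IsUltrametricDist F] {g : GL (Fin 2) F} :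
    g ∈ KZ F ↔ ∃ t : F, t ≠ 0 ∧ ∃ m : Matrix (Fin 2) (Fin 2) F, (∀ i j, ‖m i j‖ ≤ 1) ∧
      ‖m.det‖ = 1 ∧ g.val = t • m := by
  constructor
  · intro hg
    obtain ⟨_, ⟨k, rfl⟩, z, hz, rfl⟩ := Subgroup.mem_sup_of_normal_right.1 hg
    rw [Matrix.GeneralLinearGroup.center_eq_range_scalar] at hz
    obtain ⟨t, rfl⟩ := hz
    refine ⟨t, t.ne_zero, (Matrix.GeneralLinearGroup.map (integers F).subtype k).val,
      fun i j => mem_integers.1 (k.val i j).2, ?_, ?_⟩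
    · have h1 : ((Matrix.GeneralLinearGroup.map (integers F).subtype k).val).det = k.val.det := by
        simp [Matrix.det_fin_two]
      have h2 : ‖((k.val.det : integers F) : F)‖ ≤ 1 := mem_integers.1 (SetLike.coe_mem _)
      have h3 : IsUnit k.val.det := (Matrix.isUnit_iff_isUnit_det _).1 k.isUnit
      rw [h1]
      refine le_antisymm h2 ?_
      by_contra! hlt
      exact (mem_maximalIdeal_iff.2 hlt) h3
    · rw [Units.val_mul, Matrix.GeneralLinearGroup.coe_scalar, Matrix.scalar_apply,
        ← Matrix.smul_one_eq_diagonal, mul_smul_comm, mul_one]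
  · rintro ⟨t, ht, m, hm, hdet, hg⟩
    let m' : Matrix (Fin 2) (Fin 2) (integers F) := fun i j => ⟨m i j, mem_integers.2 (hm i j)⟩
    have h1 : ((m'.det : integers F) : F) = m.det := by
      rw [Matrix.det_fin_two, Matrix.det_fin_two]
      simp [m']
    have h2 : IsUnit m' := by
      rw [Matrix.isUnit_iff_isUnit_det]
      by_contra h
      have h3 := mem_maximalIdeal_iff.1 (show m'.det ∈ IsLocalRing.maximalIdeal (integers F) from h)
      rw [h1, hdet] at h3
      exact lt_irrefl _ h3
    obtain ⟨k, hk⟩ := h2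
    refine Subgroup.mem_sup_of_normal_right.2 ⟨_, ⟨k, rfl⟩,
      Matrix.GeneralLinearGroup.scalar (Fin 2) (Units.mk0 t ht), ?_, ?_⟩
    · rw [Matrix.GeneralLinearGroup.center_eq_range_scalar]
      exact ⟨_, rfl⟩
    · apply Units.ext
      rw [Units.val_mul, hg, Matrix.GeneralLinearGroup.coe_scalar, Matrix.scalar_apply,
        ← Matrix.smul_one_eq_diagonal, mul_smul_comm, mul_one]
      ext i j
      simp [hk, m']
      exact Or.inl rfl

section RhoIntegrality

variable {p : ℕ} [Fact p.Prime]
variable {F : Type*} [NormedField F] [IsUltrametricDist F] [NormedAlgebra ℚ_[p] F]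
  [FiniteDimensional ℚ_[p] F]
variable {E : Type*} [NormedField E] [IsUltrametricDist E] [NormedAlgebra ℚ_[p] E]
variable {ϖ : integers F} {d : (F →ₐ[ℚ_[p]] E) → ℕ} {s : (F →ₐ[ℚ_[p]] E) → E}

/-- The twist makes scalars act through units: a scalar `t` contributes `σ t ^ d σ`, its determinant
has order `2 * ord ϖ t`, and `halfPow ^ 2 = σ ϖ ^ d σ`, so the total factor has norm one. -/
theorem isIntegralEnd_rho (hϖ : IsUniformizer ϖ) (hs : IsSqrtChoice ϖ d s) {κ : GL (Fin 2) F}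
    (hκ : κ ∈ KZ F) : IsIntegralEnd (rho hϖ hs κ) := by
  obtain ⟨t, ht, m, hm, hdet, hg⟩ := mem_KZ_iff.1 hκ
  refine isIntegralEnd_rhoMap fun σ i j => ?_
  have hord : ord ϖ κ.val.det = 2 * ord ϖ t := hϖ.ord_eq (by
    rw [hg, Matrix.det_smul, norm_mul, hdet, mul_one, norm_pow, hϖ.norm_eq ht, Fintype.card_fin,
      ← zpow_natCast, ← zpow_mul, mul_comm]
    rfl)
  have hsym : symRep hϖ hs σ κ
      = (halfPow ϖ d s σ ^ (-(2 * ord ϖ t)) * σ t ^ d σ) • symAction E (d σ) (m.map σ) := by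
    change halfPow ϖ d s σ ^ (-ord ϖ κ.val.det) • symAction E (d σ) (κ.val.map σ) = _
    rw [hord, hg, show (t • m).map σ = σ t • m.map σ by ext; simp, symAction_smul, smul_smul]
  have hnorm : ‖halfPow ϖ d s σ ^ (-(2 * ord ϖ t)) * σ t ^ d σ‖ = 1 := by
    rw [zpow_neg, zpow_mul, zpow_ofNat, halfPow_sq hs, norm_mul, norm_inv, norm_zpow, norm_pow,
      norm_pow, norm_algHom, norm_algHom, hϖ.norm_eq ht, ← zpow_natCast, ← zpow_natCast,
      ← zpow_mul, ← zpow_mul, mul_comm (d σ : ℤ)]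
    exact inv_mul_cancel₀ (zpow_pos hϖ.norm_pos _).ne'
  rw [hsym, LinearMap.smul_apply, map_smul, Finsupp.smul_apply, smul_eq_mul, norm_mul, hnorm,
    one_mul]
  exact norm_symBasis_repr_symAction_le _ _
    (fun i j => (norm_algHom_le σ _).trans (hm i j)) _ _

theorem isIntegralEnd_Ud (ϖ : integers F) (d : (F →ₐ[ℚ_[p]] E) → ℕ) :
    IsIntegralEnd (Ud ϖ d) := by
  refine isIntegralEnd_rhoMap fun σ i j => norm_symBasis_repr_symAction_le _ _ (fun i j => ?_) _ _
  have h := (norm_algHom_le σ (ϖ : F)).trans (mem_integers.1 ϖ.2)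
  fin_cases i <;> fin_cases j <;> simp [h]

theorem rho_mem_rhoBall_iff (hϖ : IsUniformizer ϖ) (hs : IsSqrtChoice ϖ d s) {κ : GL (Fin 2) F}
    (hκ : κ ∈ KZ F) {δ : NNReal} {v : RhoSpace d} :
    rho hϖ hs κ v ∈ rhoBall d δ ↔ v ∈ rhoBall d δ := by
  refine ⟨fun h => ?_, (isIntegralEnd_rho hϖ hs hκ).apply_mem⟩
  have h1 := (isIntegralEnd_rho hϖ hs (inv_mem hκ)).apply_mem h
  rwa [← Module.End.mul_apply, ← map_mul, inv_mul_cancel, map_one, Module.End.one_apply] at h1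

/-- On the double coset `ψ` is a composite of elements of `ρ(KZ)` and `U_d`, all integral. Hence `T`
introduces no denominators. -/
theorem psi_mem_rhoBall (hϖ : IsUniformizer ϖ) (hs : IsSqrtChoice ϖ d s) (x : GL (Fin 2) F)
    {δ : NNReal} {v : RhoSpace d} (hv : v ∈ rhoBall d δ) : psi hϖ hs x v ∈ rhoBall d δ := by
  by_cases hx : x ∈ DoubleCoset.doubleCoset (alpha hϖ)⁻¹ (KZ F : Set (GL (Fin 2) F)) (KZ F)
  · obtain ⟨κ₁, h₁, κ₂, h₂, rfl⟩ := DoubleCoset.mem_doubleCoset.1 hx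
    rw [psi_apply hϖ hs h₁ h₂, psi_alpha_inv]
    exact (isIntegralEnd_rho hϖ hs h₁).apply_mem ((isIntegralEnd_Ud ϖ d).apply_mem
      ((isIntegralEnd_rho hϖ hs h₂).apply_mem hv))
  · rw [psi, if_neg hx]
    exact zero_mem _

/-- The matrix `!![1, μ; 0, 1]`. -/
def unip {F : Type*} [Field F] (μ : F) : GL (Fin 2) F :=
  Matrix.GeneralLinearGroup.mkOfDetNeZero !![1, μ; 0, 1] (by simp [Matrix.det_fin_two])

theorem alpha_mem_doubleCoset (hϖ : IsUniformizer ϖ) :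
    alpha hϖ ∈ DoubleCoset.doubleCoset (alpha hϖ)⁻¹ (KZ F : Set (GL (Fin 2) F)) (KZ F) := by
  have h0 := hϖ.coe_ne_zero
  -- The identity is `α = w α⁻¹ (ϖ w)`, with `w` the exchange of coordinates.
  let w : GL (Fin 2) F :=
    Matrix.GeneralLinearGroup.mkOfDetNeZero !![0, 1; 1, 0] (by simp [Matrix.det_fin_two])
  let w' : GL (Fin 2) F :=
    Matrix.GeneralLinearGroup.mkOfDetNeZero ((ϖ : F) • !![0, 1; 1, 0])
      (by simp [Matrix.det_fin_two, h0])
  refine DoubleCoset.mem_doubleCoset.2 ⟨w, mem_KZ_iff.2 ⟨1, one_ne_zero, !![0, 1; 1, 0], ?_, ?_, ?_⟩,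
    w', mem_KZ_iff.2 ⟨ϖ, h0, !![0, 1; 1, 0], ?_, ?_, rfl⟩, ?_⟩
  · intro i j
    fin_cases i <;> fin_cases j <;> simp
  · simp [Matrix.det_fin_two]
  · rw [one_smul]
    rfl
  · intro i j
    fin_cases i <;> fin_cases j <;> simp
  · simp [Matrix.det_fin_two]
  · apply Units.ext
    rw [Units.val_mul, Units.val_mul, alpha_inv_val]
    ext i j
    fin_cases i <;> fin_cases j <;>
      simp [alpha, w, w', Matrix.GeneralLinearGroup.mkOfDetNeZero, Matrix.mul_apply,
        Fin.sum_univ_two, h0]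

/-- The determinant of `α` has order one, so the factor `halfPow` in `ψ` cancels the twist in `ρ`.
What remains is the substitution by the product matrix `α * unip μ`. -/
theorem psi_alpha_rho_unip (hϖ : IsUniformizer ϖ) (hs : IsSqrtChoice ϖ d s) (μ : F)
    (v : RhoSpace d) :
    psi hϖ hs (alpha hϖ) (rho hϖ hs (unip μ) v)
      = rhoMap d (fun σ => symAction E (d σ) !![1, σ μ; 0, σ ϖ]) v := by
  have hord : ord ϖ (alpha hϖ).val.det = 1 := hϖ.ord_eq (by
    simp [alpha, Matrix.GeneralLinearGroup.mkOfDetNeZero, Matrix.det_fin_two])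
  have hord' : ord ϖ (unip μ).val.det = 0 := hϖ.ord_eq (by
    simp [unip, Matrix.GeneralLinearGroup.mkOfDetNeZero, Matrix.det_fin_two])
  rw [psi, if_pos (alpha_mem_doubleCoset hϖ)]
  change (rhoMap d _ * rhoMap d _) v = _
  rw [← map_mul]
  congr 2
  funext σ
  have h0 := halfPow_ne_zero hϖ hs σ
  change halfPow ϖ d s σ • (halfPow ϖ d s σ ^ (-ord ϖ (alpha hϖ).val.det) •
    symAction E (d σ) ((alpha hϖ).val.map σ)) * (halfPow ϖ d s σ ^ (-ord ϖ (unip μ).val.det) •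
      symAction E (d σ) ((unip μ).val.map σ)) = _
  rw [hord, hord', neg_zero, zpow_zero, one_smul, smul_smul, zpow_neg_one, mul_inv_cancel₀ h0,
    one_smul, ← map_mul]
  congr 1
  ext i j
  fin_cases i <;> fin_cases j <;>
    simp [alpha, unip, Matrix.GeneralLinearGroup.mkOfDetNeZero, Matrix.mul_apply]

/-- The top row of that matrix is `(1, σ μ)`, so the coordinate of index `0` is `∑ c_i ∏ σ(μ) ^
i_σ`. Varying `μ` in this single coordinate recovers bounds for all `c_i`. -/
theorem mem_rhoBall_of_forall_psi_alpha {f : ℕ}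
    (hf : Nat.card (IsLocalRing.ResidueField (integers F)) = p ^ f)
    (hϖ : IsUniformizer ϖ) (hs : IsSqrtChoice ϖ d s) (ι : F →ₐ[ℚ_[p]] E)
    (hd₁ : ∀ l < f, (J f ι d l).ncard ≤ 1)
    (hd₂ : ∀ l < f, ∀ σ ∈ J f ι d l, d σ + 1 ≤ p ^ gap f ι d l)
    {δ : NNReal} {v : RhoSpace d}
    (hv : ∀ μ : F, ‖μ‖ ≤ 1 → psi hϖ hs (alpha hϖ) (rho hϖ hs (unip μ) v) ∈ rhoBall d δ) :
    v ∈ rhoBall d δ := by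
  classical
  refine norm_le_of_forall_norm_sum_le hf hϖ ι hd₁ hd₂ (fun i => (rhoBasis d).repr v i) δ.2
    fun μ hμ => ?_
  have h := hv μ hμ fun _ => 0
  rw [psi_alpha_rho_unip, rhoBasis_repr_apply] at h
  convert h using 4 with i
  rw [rhoBasis_repr_rhoMap]
  refine Finset.prod_congr rfl fun σ _ => ?_
  rw [symBasis_repr_symAction_zero]
  simp

end RhoIntegrality

/-! ### Column norms on `GL₂(F)` -/

section Height

variable {F : Type*} [NormedField F]

theorem det_val_ne_zero (y : GL (Fin 2) F) : y.val.det ≠ 0 :=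
  ((Matrix.isUnit_iff_isUnit_det _).1 y.isUnit).ne_zero

/-- The square of the norm of the column of index `j`, divided by the norm of the determinant. -/
def height (j : Fin 2) (y : GL (Fin 2) F) : ℝ :=
  max ‖y.val 0 j‖ ‖y.val 1 j‖ ^ 2 / ‖y.val.det‖

theorem height_pos (j : Fin 2) (y : GL (Fin 2) F) : 0 < height j y := by
  have hdet := det_val_ne_zero y
  refine div_pos (pow_pos ?_ 2) (norm_pos_iff.2 hdet)
  by_contra! h
  have h0 := norm_le_zero_iff.1 ((le_max_left _ _).trans h)
  have h1 := norm_le_zero_iff.1 ((le_max_right _ _).trans h)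
  rw [Matrix.det_fin_two] at hdet
  fin_cases j <;> simp_all

/-- The matrix `!![0, 1; 1, 0]`. -/
def swap (F : Type*) [Field F] : GL (Fin 2) F :=
  Matrix.GeneralLinearGroup.mkOfDetNeZero !![0, 1; 1, 0] (by simp [Matrix.det_fin_two])

theorem swap_val (F : Type*) [Field F] : (swap F).val = !![0, 1; 1, 0] := rfl

theorem swap_mul_swap (F : Type*) [Field F] : swap F * swap F = 1 := by
  ext i j
  fin_cases i <;> fin_cases j <;> simp [swap_val, Matrix.mul_apply, Fin.sum_univ_two]

theorem height_mul_swap (y : GL (Fin 2) F) : height 0 (y * swap F) = height 1 y := by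
  simp [height, swap_val, Matrix.mul_apply, Fin.sum_univ_two, Matrix.det_fin_two]
  congr 1
  rw [← norm_neg]
  congr 1
  ring

/-- The matrix `!![a, x; 0, 1]`. -/
def affineGL (a x : F) (ha : a ≠ 0) : GL (Fin 2) F :=
  Matrix.GeneralLinearGroup.mkOfDetNeZero !![a, x; 0, 1] (by simpa [Matrix.det_fin_two] using ha)

theorem affineGL_val (a x : F) (ha : a ≠ 0) : (affineGL a x ha).val = !![a, x; 0, 1] := rfl

theorem height_zero_affineGL (a x : F) (ha : a ≠ 0) : height 0 (affineGL a x ha) = ‖a‖ := by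
  have h : ‖a‖ ≠ 0 := norm_ne_zero_iff.2 ha
  simp [height, affineGL_val, Matrix.det_fin_two]
  field_simp

theorem height_one_affineGL (a x : F) (ha : a ≠ 0) :
    height 1 (affineGL a x ha) = max ‖x‖ 1 ^ 2 / ‖a‖ := by
  simp [height, affineGL_val, Matrix.det_fin_two]

variable [IsUltrametricDist F]

theorem affineGL_mem_KZ {a x : F} (ha : ‖a‖ = 1) (hx : ‖x‖ ≤ 1) :
    affineGL a x (norm_ne_zero_iff.1 (ha ▸ one_ne_zero)) ∈ KZ F := by
  refine mem_KZ_iff.2 ⟨1, one_ne_zero, !![a, x; 0, 1], ?_, ?_, (one_smul _ _).symm⟩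
  · intro i j
    fin_cases i <;> fin_cases j <;> simp [ha, hx]
  · simpa [Matrix.det_fin_two] using ha

theorem swap_mem_KZ : swap F ∈ KZ F := by
  refine mem_KZ_iff.2 ⟨1, one_ne_zero, !![0, 1; 1, 0], ?_, ?_, (one_smul _ _).symm⟩
  · intro i j
    fin_cases i <;> fin_cases j <;> simp
  · simp [Matrix.det_fin_two]

theorem height_mul_le {κ : GL (Fin 2) F} (hκ : κ ∈ KZ F) (j : Fin 2) (y : GL (Fin 2) F) :
    height j (κ * y) ≤ height j y := by
  obtain ⟨t, ht, m, hm, hdet, hg⟩ := mem_KZ_iff.1 hκ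
  have hd : 0 < ‖y.val.det‖ := norm_pos_iff.2 (det_val_ne_zero y)
  have ht' : 0 < ‖t‖ := norm_pos_iff.2 ht
  set C := max ‖y.val 0 j‖ ‖y.val 1 j‖ with hC
  have hle : ∀ i, ‖(κ * y).val i j‖ ≤ ‖t‖ * C := by
    intro i
    rw [Units.val_mul, hg, Matrix.smul_mul, Matrix.smul_apply, smul_eq_mul, norm_mul,
      Matrix.mul_apply, Fin.sum_univ_two]
    gcongr
    refine norm_add_le_of_le ?_ ?_ <;> rw [norm_mul]
    · exact (mul_le_of_le_one_left (norm_nonneg _) (hm _ _)).trans (le_max_left _ _)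
    · exact (mul_le_of_le_one_left (norm_nonneg _) (hm _ _)).trans (le_max_right _ _)
  have hdet' : ‖(κ * y).val.det‖ = ‖t‖ ^ 2 * ‖y.val.det‖ := by
    rw [Units.val_mul, Matrix.det_mul, hg, Matrix.det_smul, norm_mul, norm_mul, hdet, mul_one,
      norm_pow, Fintype.card_fin]
  rw [height, height, hdet', ← hC]
  calc _ ≤ (‖t‖ * C) ^ 2 / (‖t‖ ^ 2 * ‖y.val.det‖) := by
        gcongr
        exact max_le (hle 0) (hle 1)
    _ = C ^ 2 / ‖y.val.det‖ := by field_simp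

theorem height_mul {κ : GL (Fin 2) F} (hκ : κ ∈ KZ F) (j : Fin 2) (y : GL (Fin 2) F) :
    height j (κ * y) = height j y := by
  refine le_antisymm (height_mul_le hκ j y) ?_
  simpa using height_mul_le (inv_mem hκ) j (κ * y)

/-- Iwasawa decomposition: once the larger entry of the first column is on top, an integral row
operation clears the other, and a scalar normalizes the last entry. -/
theorem exists_eq_mul_affineGL (y : GL (Fin 2) F) :
    ∃ κ ∈ KZ F, ∃ (a x : F) (ha : a ≠ 0), y = κ * affineGL a x ha := by
  have hex : ∃ κ ∈ KZ F, (κ * y).val 1 0 = 0 := by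
    have hcase : ∀ z : GL (Fin 2) F, ‖z.val 1 0‖ ≤ ‖z.val 0 0‖ →
        ∃ κ ∈ KZ F, (κ * z).val 1 0 = 0 := by
      intro z hz
      have h0 : z.val 0 0 ≠ 0 := by
        intro h0
        have h1 : z.val 1 0 = 0 := by simpa [h0] using hz
        exact det_val_ne_zero z (by simp [Matrix.det_fin_two, h0, h1])
      refine ⟨Matrix.GeneralLinearGroup.mkOfDetNeZero !![1, 0; -(z.val 1 0 / z.val 0 0), 1]
        (by simp [Matrix.det_fin_two]), mem_KZ_iff.2 ⟨1, one_ne_zero, _, ?_, ?_,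
          (one_smul _ _).symm⟩, ?_⟩
      · have h2 : ‖z.val 1 0‖ / ‖z.val 0 0‖ ≤ 1 := div_le_one_of_le₀ hz (norm_nonneg _)
        intro i j
        fin_cases i <;> fin_cases j <;>
          simp [Matrix.GeneralLinearGroup.mkOfDetNeZero, h2]
      · simp [Matrix.GeneralLinearGroup.mkOfDetNeZero, Matrix.det_fin_two]
      · simp [Matrix.GeneralLinearGroup.mkOfDetNeZero, Matrix.mul_apply, Fin.sum_univ_two, h0]
    rcases le_total ‖y.val 1 0‖ ‖y.val 0 0‖ with h | h
    · exact hcase y h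
    · obtain ⟨κ, hκ, h1⟩ := hcase (swap F * y)
        (by simpa [swap_val, Matrix.mul_apply, Fin.sum_univ_two] using h)
      exact ⟨κ * swap F, mul_mem hκ swap_mem_KZ, by rwa [mul_assoc]⟩
  obtain ⟨κ, hκ, h0⟩ := hex
  set z := κ * y with hz
  have hdet := det_val_ne_zero z
  rw [Matrix.det_fin_two, h0, mul_zero, sub_zero] at hdet
  have ha := left_ne_zero_of_mul hdet
  have hd := right_ne_zero_of_mul hdet
  let t := Matrix.GeneralLinearGroup.scalar (Fin 2) (Units.mk0 (z.val 1 1) hd)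
  have ht : t ∈ KZ F := Subgroup.mem_sup_right (by
    rw [Matrix.GeneralLinearGroup.center_eq_range_scalar]
    exact ⟨_, rfl⟩)
  refine ⟨κ⁻¹ * t, mul_mem (inv_mem hκ) ht, z.val 0 0 / z.val 1 1, z.val 0 1 / z.val 1 1,
    div_ne_zero ha hd, ?_⟩
  rw [mul_assoc, eq_inv_mul_iff_mul_eq, ← hz]
  apply Units.ext
  rw [Units.val_mul t, Matrix.GeneralLinearGroup.coe_scalar, Matrix.scalar_apply,
    ← Matrix.smul_one_eq_diagonal, smul_mul_assoc, one_mul, affineGL_val]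
  ext i j
  fin_cases i <;> fin_cases j <;> simp [h0] <;> field_simp

/-- Two horoballs centred at distinct ends meet in finitely many vertices. On Iwasawa
representatives the two bounds confine `a` and `x` to a compact set with `a` away from zero, and
nearby pairs give the same coset. -/
theorem exists_finset_of_height_le [ProperSpace F] (r : ℝ) :
    ∃ B : Finset (GL (Fin 2) F), ∀ y, height 0 y ≤ r → height 1 y ≤ r →
      ∃ b ∈ B, y * b⁻¹ ∈ KZ F := by
  classical
  wlog hr : 1 ≤ r generalizing r
  · obtain ⟨B, hB⟩ := this 1 le_rfl
    exact ⟨B, fun y h0 h1 => hB y (h0.trans (not_le.1 hr).le) (h1.trans (not_le.1 hr).le)⟩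
  have hr0 : 0 < r := zero_lt_one.trans_le hr
  let S : Set (F × F) := {c | r⁻¹ ≤ ‖c.1‖ ∧ ‖c.1‖ ≤ r ∧ ‖c.2‖ ≤ r}
  have hS : IsCompact S := by
    apply Metric.isCompact_of_isClosed_isBounded
    · exact (isClosed_le continuous_const continuous_fst.norm).inter
        ((isClosed_le continuous_fst.norm continuous_const).inter
          (isClosed_le continuous_snd.norm continuous_const))
    · exact (Metric.isBounded_closedBall (x := (0 : F × F)) (r := r)).subset fun c hc => by
        rw [mem_closedBall_zero_iff]
        exact max_le hc.2.1 hc.2.2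
  -- The radius `r⁻²` is chosen so that `(a - a') / a' * x'` is integral when `‖a'‖ ≥ r⁻¹` and `‖x'‖
  -- ≤ r`.
  obtain ⟨t, htS, htf, htc⟩ := hS.finite_cover_balls (e := (r ^ 2)⁻¹) (by positivity)
  refine ⟨htf.toFinset.image fun c => if h : c.1 ≠ 0 then affineGL c.1 c.2 h else 1, ?_⟩
  intro y h0 h1
  obtain ⟨κ, hκ, a, x, ha, rfl⟩ := exists_eq_mul_affineGL y
  have ha0 : 0 < ‖a‖ := norm_pos_iff.2 ha
  rw [height_mul hκ, height_zero_affineGL] at h0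
  rw [height_mul hκ, height_one_affineGL, div_le_iff₀ ha0] at h1
  have h2 : (1 : ℝ) ≤ r * ‖a‖ :=
    (one_le_pow₀ (le_max_right ‖x‖ 1)).trans h1
  have h3 : ‖x‖ ≤ r := by
    have h4 : ‖x‖ ^ 2 ≤ r ^ 2 := by
      calc ‖x‖ ^ 2 ≤ max ‖x‖ 1 ^ 2 := by
            gcongr
            exact le_max_left _ _
        _ ≤ r * ‖a‖ := h1
        _ ≤ r * r := by gcongr
        _ = r ^ 2 := (sq r).symm
    exact (sq_le_sq₀ (norm_nonneg _) hr0.le).1 h4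
  have hmem : (a, x) ∈ S := ⟨by rwa [inv_le_iff_one_le_mul₀' hr0], h0, h3⟩
  obtain ⟨⟨a', x'⟩, hc, hdist⟩ := Set.mem_iUnion₂.1 (htc hmem)
  obtain ⟨ha'1, ha'2, hx'⟩ := htS hc
  rw [Metric.mem_ball, Prod.dist_eq, max_lt_iff, dist_eq_norm, dist_eq_norm] at hdist
  obtain ⟨hda, hdx⟩ := hdist
  simp only at ha'1 ha'2 hx' hda hdx
  have ha'0 : 0 < ‖a'‖ := (inv_pos.2 hr0).trans_le ha'1
  have ha' : a' ≠ 0 := norm_pos_iff.1 ha'0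
  have hr2 : (r ^ 2)⁻¹ ≤ r⁻¹ := by
    apply inv_anti₀ hr0
    nlinarith
  have hr1 : r⁻¹ ≤ 1 := inv_le_one_of_one_le₀ hr
  have hnorm : ‖a‖ = ‖a'‖ := by
    have h5 : ‖a - a'‖ < ‖a'‖ := hda.trans_le (hr2.trans ha'1)
    have h6 := IsUltrametricDist.norm_add_eq_max_of_norm_ne_norm h5.ne
    rwa [sub_add_cancel, max_eq_right h5.le] at h6
  have hu : ‖a / a'‖ = 1 := by rw [norm_div, hnorm, div_self ha'0.ne']
  have hv : ‖x - a / a' * x'‖ ≤ 1 := by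
    have h7 : x - a / a' * x' = (x - x') - (a - a') / a' * x' := by
      field_simp
      ring
    rw [h7]
    refine norm_sub_le_of_le (hdx.le.trans (hr2.trans hr1)) ?_
    rw [norm_mul, norm_div]
    calc ‖a - a'‖ / ‖a'‖ * ‖x'‖ ≤ (r ^ 2)⁻¹ / r⁻¹ * r := by
          gcongr
      _ = 1 := by field_simp
  refine ⟨affineGL a' x' ha', Finset.mem_image.2 ⟨(a', x'), htf.mem_toFinset.2 hc, dif_pos ha'⟩, ?_⟩
  have h8 : affineGL a x ha
      = affineGL (a / a') (x - a / a' * x') (div_ne_zero ha ha') * affineGL a' x' ha' := by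
    ext i j
    fin_cases i <;> fin_cases j <;>
      simp [affineGL_val, Matrix.mul_apply, Fin.sum_univ_two, ha']
  rw [h8, mul_assoc, mul_assoc, mul_inv_cancel, mul_one]
  exact mul_mem hκ (affineGL_mem_KZ hu hv)

/-- Except in the direction of `α`, every neighbour lies higher. Up to a scalar, `x⁻¹` is integral
with determinant of norm `‖ϖ‖`, and its first column turns out to be primitive; the column norm is
then unchanged while the determinant gains a factor `‖ϖ‖`. -/
theorem height_inv_mul {ϖ : integers F} (hϖ : IsUniformizer ϖ) {x : GL (Fin 2) F}
    (hx : x ∈ DoubleCoset.doubleCoset (alpha hϖ)⁻¹ (KZ F : Set (GL (Fin 2) F)) (KZ F))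
    (hxα : (alpha hϖ)⁻¹ * x ∉ KZ F) {y : GL (Fin 2) F} (hy : y.val 1 0 = 0) :
    height 0 (x⁻¹ * y) = height 0 y / ‖(ϖ : F)‖ := by
  have h0 := hϖ.coe_ne_zero
  obtain ⟨t, ht, m, hm, hdet, hval⟩ : ∃ t : F, t ≠ 0 ∧ ∃ m : Matrix (Fin 2) (Fin 2) F,
      (∀ i j, ‖m i j‖ ≤ 1) ∧ ‖m.det‖ = ‖(ϖ : F)‖ ∧ (x⁻¹).val = t • m := by
    obtain ⟨κ₁, h₁, κ₂, h₂, rfl⟩ := DoubleCoset.mem_doubleCoset.1 hx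
    obtain ⟨t₁, ht₁, m₁, hm₁, hdet₁, hg₁⟩ := mem_KZ_iff.1 (inv_mem h₁)
    obtain ⟨t₂, ht₂, m₂, hm₂, hdet₂, hg₂⟩ := mem_KZ_iff.1 (inv_mem h₂)
    refine ⟨t₂ * t₁, mul_ne_zero ht₂ ht₁, m₂ * !![1, 0; 0, (ϖ : F)] * m₁, ?_, ?_, ?_⟩
    · have hmul : ∀ A B : Matrix (Fin 2) (Fin 2) F, (∀ i j, ‖A i j‖ ≤ 1) → (∀ i j, ‖B i j‖ ≤ 1) →
          ∀ i j, ‖(A * B) i j‖ ≤ 1 := by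
        intro A B hA hB i j
        rw [Matrix.mul_apply, Fin.sum_univ_two]
        refine norm_add_le_of_le ?_ ?_ <;> rw [norm_mul] <;>
          exact mul_le_one₀ (hA _ _) (norm_nonneg _) (hB _ _)
      refine hmul _ _ (hmul _ _ hm₂ fun i j => ?_) hm₁
      fin_cases i <;> fin_cases j <;> simp [mem_integers.1 ϖ.2]
    · rw [Matrix.det_mul, Matrix.det_mul, norm_mul, norm_mul, hdet₁, hdet₂]
      simp [Matrix.det_fin_two]
    · rw [show (κ₁ * (alpha hϖ)⁻¹ * κ₂)⁻¹ = κ₂⁻¹ * alpha hϖ * κ₁⁻¹ by group, Units.val_mul,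
        Units.val_mul, hg₁, hg₂]
      simp only [Matrix.smul_mul, Matrix.mul_smul, smul_smul]
      rw [mul_comm]
      rfl
  have hcol : max ‖m 0 0‖ ‖m 1 0‖ = 1 := by
    refine le_antisymm (max_le (hm _ _) (hm _ _)) ?_
    -- A first column divisible by `ϖ` would put `x⁻¹ * alpha hϖ` in `KZ`, which `hxα` excludes.
    by_contra! hlt
    have hle : ∀ i, ‖m i 0 / ϖ‖ ≤ 1 := by
      have hlt' := max_lt_iff.1 hlt
      intro i
      rw [norm_div]
      refine div_le_one_of_le₀ (hϖ.norm_le ?_) (norm_nonneg _)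
      fin_cases i
      exacts [hlt'.1, hlt'.2]
    refine hxα ?_
    rw [← inv_inv ((alpha hϖ)⁻¹ * x)]
    refine inv_mem (mem_KZ_iff.2 ⟨t * ϖ, mul_ne_zero ht h0,
      !![m 0 0 / ϖ, m 0 1; m 1 0 / ϖ, m 1 1], ?_, ?_, ?_⟩)
    · intro i j
      fin_cases i <;> fin_cases j <;>
        first | exact hm _ _ | exact hle _
    · have h1 : m.det = ϖ * (!![m 0 0 / ϖ, m 0 1; m 1 0 / ϖ, m 1 1] :
          Matrix (Fin 2) (Fin 2) F).det := by
        rw [Matrix.det_fin_two, Matrix.det_fin_two_of]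
        field_simp
      rw [h1, norm_mul] at hdet
      exact (mul_eq_left₀ hϖ.norm_pos.ne').1 hdet
    · rw [mul_inv_rev, inv_inv, Units.val_mul, hval]
      ext i j
      fin_cases i <;> fin_cases j <;>
        simp [alpha, Matrix.GeneralLinearGroup.mkOfDetNeZero, Matrix.mul_apply,
          Fin.sum_univ_two] <;> field_simp
  have ht' : 0 < ‖t‖ := norm_pos_iff.2 ht
  have hent : ∀ i, (x⁻¹ * y).val i 0 = t * y.val 0 0 * m i 0 := by
    intro i
    rw [Units.val_mul, hval, Matrix.mul_apply, Fin.sum_univ_two, hy]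
    simp
    ring
  have hdet' : ‖(x⁻¹ * y).val.det‖ = ‖t‖ ^ 2 * ‖(ϖ : F)‖ * ‖y.val.det‖ := by
    rw [Units.val_mul, Matrix.det_mul, hval, Matrix.det_smul, norm_mul, norm_mul, hdet,
      norm_pow, Fintype.card_fin]
  have hd : 0 < ‖y.val.det‖ := norm_pos_iff.2 (det_val_ne_zero y)
  have hϖ0 := hϖ.norm_pos
  rw [height, height, hdet', hent, hent, norm_mul, norm_mul _ (m 1 0),
    ← mul_max_of_nonneg _ _ (norm_nonneg _), hcol, hy, norm_zero, max_eq_left (norm_nonneg _),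
    norm_mul]
  field_simp

theorem height_alpha_mul_unip_mul {ϖ : integers F} (hϖ : IsUniformizer ϖ) (μ : F)
    {y : GL (Fin 2) F} (hy : y.val 1 0 = 0) :
    (alpha hϖ * unip μ * y).val 1 0 = 0 ∧
      height 0 (alpha hϖ * unip μ * y) = height 0 y / ‖(ϖ : F)‖ := by
  have hval : (alpha hϖ * unip μ).val = !![1, μ; 0, (ϖ : F)] := by
    ext i j
    fin_cases i <;> fin_cases j <;>
      simp [alpha, unip, Matrix.GeneralLinearGroup.mkOfDetNeZero, Matrix.mul_apply,
        Fin.sum_univ_two]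
  have h0 : (alpha hϖ * unip μ * y).val 0 0 = y.val 0 0 := by
    rw [Units.val_mul, hval]
    simp [Matrix.mul_apply, Fin.sum_univ_two, hy]
  have h1 : (alpha hϖ * unip μ * y).val 1 0 = 0 := by
    rw [Units.val_mul, hval]
    simp [Matrix.mul_apply, Fin.sum_univ_two, hy]
  have h2 : ‖(alpha hϖ * unip μ * y).val.det‖ = ‖(ϖ : F)‖ * ‖y.val.det‖ := by
    rw [Units.val_mul, Matrix.det_mul, hval, norm_mul, Matrix.det_fin_two_of]
    simp
  refine ⟨h1, ?_⟩
  rw [height, height, h0, h1, h2, hy, mul_comm, div_div]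

end Height

/-! ### Supports in compact induction -/

theorem finsum_mem_of_forall_mem {ι M : Type*} [AddCommMonoid M] (S : AddSubmonoid M) {t : ι → M}
    (h : ∀ i, t i ∈ S) : ∑ᶠ i, t i ∈ S :=
  finsum_induction (· ∈ S) S.zero_mem (fun _ _ => S.add_mem) h

theorem mem_of_finsum_mem {ι M : Type*} [AddCommGroup M] (S : AddSubgroup M) {t : ι → M}
    (ht : (Function.support t).Finite) (i : ι) (h : ∑ᶠ j, t j ∈ S) (h' : ∀ j ≠ i, t j ∈ S) :
    t i ∈ S := by
  classical
  rw [finsum_eq_sum_of_support_subset t (s := insert i ht.toFinset)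
      (fun j hj => Finset.mem_coe.2 (Finset.mem_insert_of_mem (ht.mem_toFinset.2 hj))),
    ← Finset.add_sum_erase _ _ (Finset.mem_insert_self i _)] at h
  exact (S.add_mem_cancel_right
    (S.sum_mem fun j hj => h' j (Finset.ne_of_mem_erase hj))).1 h

section Induction

variable {R G V : Type*} [CommRing R] [Group G] [AddCommGroup V] [Module R V]
variable {H : Subgroup G} {ρ : Representation R G V} {φ : G → Module.End R V}

variable (H ρ) in
/-- The functions in `ind ρ` with support in the union of the cosets `H b` for `b ∈ B`. -/
def indSupported (B : Finset G) : Submodule R (ind H ρ) where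
  carrier := {f | ∀ g, f.1 g ≠ 0 → ∃ b ∈ B, g * b⁻¹ ∈ H}
  zero_mem' g hg := (hg rfl).elim
  add_mem' {f₁ f₂} h₁ h₂ g hg := by
    by_cases h : f₁.1 g = 0
    · exact h₂ g fun h' => hg (by
        change f₁.1 g + f₂.1 g = 0
        rw [h, h', add_zero])
    · exact h₁ g h
  smul_mem' c f h g hg := h g fun h' => hg (by
    change c • f.1 g = 0
    rw [h', smul_zero])

theorem indSupported_mono {A B : Finset G} (h : A ⊆ B) :
    indSupported H ρ A ≤ indSupported H ρ B := fun _ hf g hg =>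
  let ⟨a, ha, hm⟩ := hf g hg
  ⟨a, h ha, hm⟩

theorem exists_mem_indSupported (f : ind H ρ) : ∃ B, f ∈ indSupported H ρ B := f.2.2

/-- The restriction of a function in `ind ρ` to a finite union of cosets. -/
def indTruncate (B : Finset G) (f : ind H ρ) : ind H ρ :=
  ⟨fun g => open Classical in if ∃ b ∈ B, g * b⁻¹ ∈ H then f.1 g else 0, by
    constructor
    · intro κ hκ g
      have h : (∃ b ∈ B, κ * g * b⁻¹ ∈ H) ↔ ∃ b ∈ B, g * b⁻¹ ∈ H :=
        exists_congr fun b => and_congr_right fun _ => by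
          rw [mul_assoc, H.mul_mem_cancel_left hκ]
      classical
      change ite _ _ _ = ρ κ (ite _ _ _)
      by_cases hg : ∃ b ∈ B, g * b⁻¹ ∈ H
      · rw [if_pos (h.2 hg), if_pos hg, f.2.1 κ hκ]
      · rw [if_neg (mt h.1 hg), if_neg hg, map_zero]
    · exact ⟨B, fun g hg => by
        by_contra h
        exact hg (if_neg h)⟩⟩

theorem indTruncate_mem (B : Finset G) (f : ind H ρ) :
    indTruncate B f ∈ indSupported H ρ B := fun g hg => by
  by_contra h
  exact hg (if_neg h)

/-- The set `C` depends on `B` only; this uniformity in `f` is what confines the limit argument to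
finitely many cosets. -/
theorem exists_heckeOperator_mem_indSupported (hφ : IsHeckeFunction H ρ φ) (B : Finset G) :
    ∃ C, ∀ f ∈ indSupported H ρ B, heckeOperator hφ f ∈ indSupported H ρ C := by
  classical
  obtain ⟨A, hA⟩ := hφ.finite_support
  refine ⟨(A ×ˢ B).image fun c => c.1 * c.2, fun f hB g hg => ?_⟩
  obtain ⟨x, hx⟩ : ∃ x, heckeTerm hφ f g x ≠ 0 := by
    by_contra! h0
    exact hg (by simp [heckeOperator_apply, h0])
  induction x using QuotientGroup.induction_on with
  | H x =>
    obtain ⟨b, hb, hbm⟩ := hB (x⁻¹ * g) fun h0 => by simp [h0] at hx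
    set y := x⁻¹ * g * b⁻¹ with hy
    have hx2 : φ (x * y) ≠ 0 := by
      intro h0
      have h1 := hφ.equivariant 1 H.one_mem _ (H.inv_mem hbm) (x * y)
      rw [h0, show 1 * (x * y) * y⁻¹ = x by group] at h1
      simp [h1] at hx
    obtain ⟨a, ha, ham⟩ := hA _ hx2
    refine ⟨a * b, Finset.mem_image.2 ⟨(a, b), Finset.mem_product.2 ⟨ha, hb⟩, rfl⟩, ?_⟩
    rwa [show g * (a * b)⁻¹ = x * y * a⁻¹ by rw [hy]; group]

theorem eq_zero_of_mem_indSupported {B : Finset G} {f : ind H ρ} (hf : f ∈ indSupported H ρ B)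
    (h : ∀ b ∈ B, f.1 b = 0) : f = 0 := by
  ext g
  by_contra hg
  obtain ⟨b, hb, hm⟩ := hf g hg
  have h1 := f.2.1 _ hm b
  rw [inv_mul_cancel_right, h b hb, map_zero] at h1
  exact hg h1

end Induction

/-! ### Descent along the tree, and the limit argument -/

section Main

variable {p : ℕ} [Fact p.Prime]
variable {F : Type*} [NormedField F] [IsUltrametricDist F] [NormedAlgebra ℚ_[p] F]
  [FiniteDimensional ℚ_[p] F]
variable {E : Type*} [NormedField E] [IsUltrametricDist E] [NormedAlgebra ℚ_[p] E]
variable {ϖ : integers F} {d : (F →ₐ[ℚ_[p]] E) → ℕ} {s : (F →ₐ[ℚ_[p]] E) → E}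

theorem exists_forall_height_le {R V : Type*} [CommRing R] [AddCommGroup V]
    [Module R V] {ρ : Representation R (GL (Fin 2) F) V} (f : ind (KZ F) ρ) :
    ∃ r, ∀ j y, f.1 y ≠ 0 → height j y ≤ r := by
  obtain ⟨B, hB⟩ := exists_mem_indSupported f
  refine ⟨∑ j, ∑ b ∈ B, height j b, fun j y hy => ?_⟩
  obtain ⟨b, hb, hm⟩ := hB y hy
  have h := height_mul hm j b
  rw [inv_mul_cancel_right] at h
  rw [h]
  calc height j b ≤ ∑ b ∈ B, height j b :=
        Finset.single_le_sum (f := fun b => height j b) (fun b _ => (height_pos j b).le) hb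
    _ ≤ _ := Finset.single_le_sum (f := fun j => ∑ b ∈ B, height j b)
        (fun j _ => Finset.sum_nonneg fun b _ => (height_pos j b).le) (Finset.mem_univ j)

theorem ind_apply_mul_mem_rhoBall_iff (hϖ : IsUniformizer ϖ) (hs : IsSqrtChoice ϖ d s)
    (f : ind (KZ F) (rho hϖ hs)) {κ : GL (Fin 2) F} (hκ : κ ∈ KZ F) (y : GL (Fin 2) F)
    {δ : NNReal} : f.1 (κ * y) ∈ rhoBall d δ ↔ f.1 y ∈ rhoBall d δ := by
  rw [f.2.1 κ hκ, rho_mem_rhoBall_iff hϖ hs hκ]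

theorem smul_mem_rhoBall_of_mem_integers {δ : NNReal} {v : RhoSpace d} {a : E}
    (ha : a ∈ integers E) (hv : v ∈ rhoBall d δ) : a • v ∈ rhoBall d δ :=
  (rhoBall d δ).smul_mem (⟨a, ha⟩ : integers E) hv

theorem heckeOperator_sub_mem_rhoBall (hϖ : IsUniformizer ϖ) (hs : IsSqrtChoice ϖ d s) {a : E}
    (ha : a ∈ integers E) {δ : NNReal} (f : ind (KZ F) (rho hϖ hs))
    (hf : ∀ y, f.1 y ∈ rhoBall d δ) (y : GL (Fin 2) F) :
    (heckeOperator (psi_isHeckeFunction hϖ hs) f - a • f).1 y ∈ rhoBall d δ := by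
  refine sub_mem ?_ (smul_mem_rhoBall_of_mem_integers ha (hf y))
  refine finsum_mem_of_forall_mem (rhoBall d δ).toAddSubmonoid fun x => ?_
  induction x using QuotientGroup.induction_on with
  | H x => exact psi_mem_rhoBall hϖ hs x (hf _)

section Key

variable {f : ℕ} (hf : Nat.card (IsLocalRing.ResidueField (integers F)) = p ^ f)
  (hϖ : IsUniformizer ϖ) (hs : IsSqrtChoice ϖ d s) (ι : F →ₐ[ℚ_[p]] E)
  (hd₁ : ∀ l < f, (J f ι d l).ncard ≤ 1)
  (hd₂ : ∀ l < f, ∀ σ ∈ J f ι d l, d σ + 1 ≤ p ^ gap f ι d l)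

include hf hd₁ hd₂

/-- Outside a horoball, `h` is as small as `(T - a) h`. -/
theorem mem_rhoBall_of_heckeOperator_sub_mem {a : E} (ha : a ∈ integers E) {δ : NNReal}
    (h : ind (KZ F) (rho hϖ hs)) {r : ℝ}
    (hr : ∀ y, r < height 0 y →
      (heckeOperator (psi_isHeckeFunction hϖ hs) h - a • h).1 y ∈ rhoBall d δ)
    (y : GL (Fin 2) F) (hy : r * ‖(ϖ : F)‖ < height 0 y) : h.1 y ∈ rhoBall d δ := by
  have hϖ0 := hϖ.norm_pos
  obtain ⟨N, hN⟩ := exists_forall_height_le h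
  -- Downward induction on the height: `h` vanishes above `N`, and each step lowers the threshold by
  -- a factor `‖ϖ‖`.
  have key : ∀ k : ℕ, ∀ y, r * ‖(ϖ : F)‖ < height 0 y → N * ‖(ϖ : F)‖ ^ k < height 0 y →
      h.1 y ∈ rhoBall d δ := by
    intro k
    induction k with
    | zero =>
      intro y _ hy
      rw [pow_zero, mul_one] at hy
      have h0 : h.1 y = 0 := by
        by_contra h0
        exact hy.not_ge (hN 0 y h0)
      rw [h0]
      exact zero_mem _
    | succ k ih =>
      intro y hy1 hy2
      obtain ⟨κ, hκ, b, x, hb, rfl⟩ := exists_eq_mul_affineGL y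
      rw [ind_apply_mul_mem_rhoBall_iff hϖ hs h hκ]
      rw [height_mul hκ] at hy1 hy2
      set y := affineGL b x hb
      have hy0 : y.val 1 0 = 0 := by simp [y, affineGL_val]
      refine mem_rhoBall_of_forall_psi_alpha hf hϖ hs ι hd₁ hd₂ fun μ hμ => ?_
      have hunip : unip μ ∈ KZ F := by
        have h1 := affineGL_mem_KZ (a := (1 : F)) (x := μ) norm_one hμ
        exact h1
      obtain ⟨hz0, hz⟩ := height_alpha_mul_unip_mul hϖ μ hy0
      set z := alpha hϖ * unip μ * y with hzdef
      have hz1 : r < height 0 z := by rwa [hz, lt_div_iff₀ hϖ0]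
      have hz2 : N * ‖(ϖ : F)‖ ^ k < height 0 z := by
        rwa [hz, lt_div_iff₀ hϖ0, mul_assoc, ← pow_succ]
      have hle : ∀ w : GL (Fin 2) F, height 0 w ≤ height 0 w / ‖(ϖ : F)‖ := fun w =>
        le_div_self (height_pos 0 w).le hϖ0 hϖ.norm_lt_one.le
      have hz3 : r * ‖(ϖ : F)‖ < height 0 z := hy1.trans_le ((hle y).trans_eq hz.symm)
      have hT : (heckeOperator (psi_isHeckeFunction hϖ hs) h).1 z ∈ rhoBall d δ := by
        -- Write `T h = (T - a) h + a h` at `z`: the first term is small by hypothesis, the second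
        -- because `z` lies above `y`.
        have h1 := add_mem (hr z hz1) (smul_mem_rhoBall_of_mem_integers ha (ih z hz3 hz2))
        have h2 : (heckeOperator (psi_isHeckeFunction hϖ hs) h - a • h).1 z + a • h.1 z
            = (heckeOperator (psi_isHeckeFunction hϖ hs) h).1 z := sub_add_cancel _ _
        rwa [h2] at h1
      -- Only the neighbour of `z` at `x = α` is lower than `z`; the induction hypothesis covers the
      -- others, so its term can be isolated.
      rw [heckeOperator_apply] at hT
      have hterm := mem_of_finsum_mem (rhoBall d δ).toAddSubgroup
        (heckeTerm_finite (psi_isHeckeFunction hϖ hs) h z) ((alpha hϖ : GL (Fin 2) F) : _ ⧸ KZ F)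
        hT (by
          intro x hx
          induction x using QuotientGroup.induction_on with
          | H x =>
            rw [heckeTerm_mk]
            by_cases hxD : x ∈ DoubleCoset.doubleCoset (alpha hϖ)⁻¹
              (KZ F : Set (GL (Fin 2) F)) (KZ F)
            · have hxα : (alpha hϖ)⁻¹ * x ∉ KZ F := fun hm => hx (QuotientGroup.eq.2 hm).symm
              have hxz := height_inv_mul hϖ hxD hxα hz0
              exact psi_mem_rhoBall hϖ hs x (ih _ (hz3.trans_le ((hle z).trans_eq hxz.symm))
                (hz2.trans_le ((hle z).trans_eq hxz.symm)))
            · rw [psi, if_neg hxD]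
              exact zero_mem _)
      rw [heckeTerm_mk, show (alpha hϖ)⁻¹ * z = unip μ * y by rw [hzdef]; group,
        h.2.1 _ hunip] at hterm
      exact hterm
  have hypos := height_pos 0 y
  -- `|N| + 1` replaces `N`, which need not be positive.
  obtain ⟨k, hk⟩ := exists_pow_lt_of_lt_one (div_pos hypos (by positivity : 0 < |N| + 1))
    hϖ.norm_lt_one
  refine key k y hy ?_
  rw [lt_div_iff₀ (by positivity)] at hk
  calc N * ‖(ϖ : F)‖ ^ k ≤ (|N| + 1) * ‖(ϖ : F)‖ ^ k := by
        gcongr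
        exact (le_abs_self N).trans (by linarith)
    _ < height 0 y := by rwa [mul_comm]

/-- The set `B` is fixed by the support of `h₀` alone, before `δ`, `g` and `h`: outside it at least
one of the two heights is so large that `h₀` vanishes above it, and the descent from that end
applies. -/
theorem exists_finset_forall_mem_rhoBall {a : E} (ha : a ∈ integers E)
    (h₀ : ind (KZ F) (rho hϖ hs)) :
    ∃ B : Finset (GL (Fin 2) F), h₀ ∈ indSupported (KZ F) (rho hϖ hs) B ∧
      ∀ (δ : NNReal) (g h : ind (KZ F) (rho hϖ hs)), (∀ y, g.1 y ∈ rhoBall d δ) →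
        heckeOperator (psi_isHeckeFunction hϖ hs) h - a • h = h₀ - g →
          ∀ y, (¬ ∃ b ∈ B, y * b⁻¹ ∈ KZ F) → h.1 y ∈ rhoBall d δ := by
  have hproper : ProperSpace F := FiniteDimensional.proper ℚ_[p] F
  obtain ⟨r, hr⟩ := exists_forall_height_le h₀
  obtain ⟨B, hB⟩ := exists_finset_of_height_le (F := F) (max r 0)
  refine ⟨B, fun y hy => hB y ((hr 0 y hy).trans (le_max_left _ _))
    ((hr 1 y hy).trans (le_max_left _ _)), fun δ g h hg hgh y hy => ?_⟩
  have hsmall : ∀ j y, max r 0 < height j y →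
      (heckeOperator (psi_isHeckeFunction hϖ hs) h - a • h).1 y ∈ rhoBall d δ := by
    intro j y hj
    rw [hgh]
    change h₀.1 y - g.1 y ∈ _
    have h0 : h₀.1 y = 0 := by
      by_contra h0
      exact ((le_max_left r 0).trans_lt hj).not_ge (hr j y h0)
    rw [h0, zero_sub]
    exact neg_mem (hg y)
  have hle : max r 0 * ‖(ϖ : F)‖ ≤ max r 0 :=
    mul_le_of_le_one_right (le_max_right _ _) hϖ.norm_lt_one.le
  by_cases hy0 : height 0 y ≤ max r 0
  · have hy1 : max r 0 < height 1 y := by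
      by_contra! hy1
      exact hy (hB y hy0 hy1)
    -- Right translation by `swap F` commutes with `T` and exchanges the two columns, hence the two
    -- ends.
    have h1 := mem_rhoBall_of_heckeOperator_sub_mem hf hϖ hs ι hd₁ hd₂ ha
      (indRep (KZ F) (rho hϖ hs) (swap F) h) (r := max r 0) (δ := δ) (fun z hz => by
        rw [heckeOperator_indRep, ← map_smul, ← map_sub]
        refine hsmall 1 (z * swap F) ?_
        rwa [← height_mul_swap, mul_assoc, swap_mul_swap, mul_one])
      (y * swap F) (by
        rw [height_mul_swap]
        exact hle.trans_lt hy1)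
    change h.1 (y * swap F * swap F) ∈ _ at h1
    rwa [mul_assoc, swap_mul_swap, mul_one] at h1
  · exact mem_rhoBall_of_heckeOperator_sub_mem hf hϖ hs ι hd₁ hd₂ ha h (hsmall 0) y
      (hle.trans_lt (not_le.1 hy0))

variable [FiniteDimensional ℚ_[p] E]

/-- The solutions `h n` need not converge, but their truncations to `B` have images under `T - a`
converging to `h₀` inside a finite-dimensional space, where the range is closed. -/
theorem mem_heckeRange_of_forall_exists {a : E} (ha : a ∈ integers E)
    (h₀ : ind (KZ F) (rho hϖ hs)) {c : NNReal} (hc : c < 1)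
    (hex : ∀ n : ℕ, ∃ g h : ind (KZ F) (rho hϖ hs), (∀ y, g.1 y ∈ rhoBall d (c ^ n)) ∧
      heckeOperator (psi_isHeckeFunction hϖ hs) h - a • h = h₀ - g) :
    h₀ ∈ heckeRange (psi_isHeckeFunction hϖ hs) a := by
  classical
  obtain ⟨B, hB₀, hB⟩ := exists_finset_forall_mem_rhoBall hf hϖ hs ι hd₁ hd₂ ha h₀
  obtain ⟨C, hC⟩ := exists_heckeOperator_mem_indSupported (psi_isHeckeFunction hϖ hs) B
  choose g h hg hgh using hex
  set T := heckeOperator (psi_isHeckeFunction hϖ hs) - a • LinearMap.id with hT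
  let W := (indSupported (KZ F) (rho hϖ hs) B).map T
  let ev : ind (KZ F) (rho hϖ hs) →ₗ[E] ((↥(B ∪ C) ×
      ((σ : F →ₐ[ℚ_[p]] E) → Fin (d σ + 1))) → E) :=
    { toFun := fun f k => (rhoBasis d).repr (f.1 k.1) k.2
      map_add' := fun f₁ f₂ => by
        ext k
        change (rhoBasis d).repr (f₁.1 k.1 + f₂.1 k.1) k.2 = _
        rw [map_add]
        rfl
      map_smul' := fun e f => by
        ext k
        change (rhoBasis d).repr (e • f.1 k.1) k.2 = _
        rw [map_smul]
        rfl }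
  -- Scalars are restricted to the complete field `ℚ_[p]`, over which finite-dimensional subspaces
  -- are closed.
  let W' : Submodule ℚ_[p] ((↥(B ∪ C) × ((σ : F →ₐ[ℚ_[p]] E) → Fin (d σ + 1))) → E) :=
    (W.map ev).restrictScalars ℚ_[p]
  have hclosed : IsClosed (W' : Set ((↥(B ∪ C) ×
      ((σ : F →ₐ[ℚ_[p]] E) → Fin (d σ + 1))) → E)) := W'.closed_of_finiteDimensional
  have hdiff : ∀ n y, (h₀ - T (indTruncate B (h n))).1 y ∈ rhoBall d (c ^ n) := by
    intro n y
    -- Both terms on the right are small: the part of `h n` off `B` is, and `T - a` preserves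
    -- smallness.
    have h1 : h₀ - T (indTruncate B (h n)) = g n + T (h n - indTruncate B (h n)) := by
      have h2 : T (h n) = h₀ - g n := hgh n
      rw [map_sub, h2]
      abel
    rw [h1]
    refine add_mem (hg n y) (heckeOperator_sub_mem_rhoBall hϖ hs ha _ (fun z => ?_) y)
    by_cases hz : ∃ b ∈ B, z * b⁻¹ ∈ KZ F
    · have h3 : (h n - indTruncate B (h n)).1 z = 0 := by
        change (h n).1 z - ite _ _ _ = 0
        rw [if_pos hz, sub_self]
      rw [h3]
      exact zero_mem _
    · have h3 : (h n - indTruncate B (h n)).1 z = (h n).1 z := by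
        change (h n).1 z - ite _ _ _ = _
        rw [if_neg hz, sub_zero]
      rw [h3]
      exact hB _ _ _ (hg n) (hgh n) z hz
  have hlim : Filter.Tendsto (fun n => ev (T (indTruncate B (h n)))) Filter.atTop
      (nhds (ev h₀)) := by
    rw [tendsto_pi_nhds]
    intro k
    rw [tendsto_iff_norm_sub_tendsto_zero]
    refine squeeze_zero (fun _ => norm_nonneg _) (fun n => ?_)
      (tendsto_pow_atTop_nhds_zero_of_lt_one c.2 (by exact_mod_cast hc))
    rw [← norm_neg, neg_sub, ← Pi.sub_apply, ← map_sub]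
    exact (hdiff n k.1 k.2).trans_eq (NNReal.coe_pow _ _)
  have hmem : ev h₀ ∈ W.map ev := hclosed.mem_of_tendsto hlim (Filter.Eventually.of_forall fun n =>
    Submodule.mem_map_of_mem (Submodule.mem_map_of_mem (indTruncate_mem B (h n))))
  obtain ⟨_, ⟨u, hu, rfl⟩, hev⟩ := hmem
  -- The difference is supported on the cosets of `B ∪ C`, at whose representatives `ev` reads its
  -- values; there it vanishes.
  have hsupp : h₀ - T u ∈ indSupported (KZ F) (rho hϖ hs) (B ∪ C) :=
    sub_mem (indSupported_mono Finset.subset_union_left hB₀)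
      (sub_mem (indSupported_mono Finset.subset_union_right (hC u hu))
        (Submodule.smul_mem _ a (indSupported_mono Finset.subset_union_left hu)))
  have hzero := eq_zero_of_mem_indSupported hsupp fun b hb => by
    apply (rhoBasis d).repr.injective
    ext i
    have h1 : ev (h₀ - T u) (⟨b, hb⟩, i) = 0 := by
      rw [map_sub, hev, sub_self]
      rfl
    rw [map_zero]
    exact h1
  exact ⟨u, (sub_eq_zero.1 hzero).symm⟩

/-- Any `c` of norm less than one is allowed, so that a uniformizer of `E` gives separatedness and
`p` excludes lines. -/
theorem eq_zero_of_forall_mem_smul_Theta {a : E} (ha : a ∈ integers E) {c : E} (hc : ‖c‖ < 1)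
    {v : PiSpace hϖ hs a} (hv : ∀ n : ℕ, ∃ w ∈ Theta hϖ hs a, v = c ^ n • w) : v = 0 := by
  obtain ⟨v, rfl⟩ := Submodule.Quotient.mk_surjective _ v
  rw [Submodule.Quotient.mk_eq_zero]
  refine mem_heckeRange_of_forall_exists hf hϖ hs ι hd₁ hd₂ ha v (c := ‖c‖₊) hc fun n => ?_
  obtain ⟨_, ⟨g, hg, rfl⟩, hgv⟩ := hv n
  have h1 : v - c ^ n • g ∈ heckeRange (psi_isHeckeFunction hϖ hs) a := by
    rw [← Submodule.Quotient.mk_eq_zero, Submodule.Quotient.mk_sub, Submodule.Quotient.mk_smul,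
      hgv, sub_eq_zero]
    rfl
  obtain ⟨h, hh⟩ := h1
  refine ⟨c ^ n • g, h, fun y i => ?_, hh⟩
  have h2 : g.1 y ∈ rhoBall d 1 := rhoIntegral_eq d ▸ hg y
  change ‖(rhoBasis d).repr (c ^ n • g.1 y) i‖ ≤ _
  rw [map_smul, Finsupp.smul_apply, smul_eq_mul, norm_mul, norm_pow]
  simpa using mul_le_of_le_one_right (pow_nonneg (norm_nonneg c) n) (h2 i)

end Key

theorem piRep_mem_Theta (hϖ : IsUniformizer ϖ) (hs : IsSqrtChoice ϖ d s) (a : E)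
    (g : GL (Fin 2) F) {v : PiSpace hϖ hs a} (hv : v ∈ Theta hϖ hs a) :
    piRep hϖ hs a g v ∈ Theta hϖ hs a := by
  obtain ⟨f, hf, rfl⟩ := hv
  exact ⟨indRep (KZ F) (rho hϖ hs) g f, fun y => hf (y * g), rfl⟩

/-- Modulo the integral action of `KZ`, a function in `ind ρ` has finitely many nonzero values, so
one power of `p` clears all denominators. -/
theorem isLattice_Theta (hϖ : IsUniformizer ϖ) (hs : IsSqrtChoice ϖ d s) (a : E) :
    IsLattice (Theta hϖ hs a) := by
  intro v
  obtain ⟨h, rfl⟩ := Submodule.Quotient.mk_surjective _ v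
  obtain ⟨B, hB⟩ := exists_mem_indSupported h
  choose δ hδ using fun b => exists_mem_rhoBall (h.1 b)
  obtain ⟨k, hk⟩ := exists_pow_lt_of_lt_one
    (inv_pos.2 (by positivity : 0 < ∑ b ∈ B, (δ b : ℝ) + 1))
    (norm_natCast_prime_lt_one (p := p) (F := E))
  refine ⟨(p : E) ^ k, pow_ne_zero _ natCast_prime_ne_zero, (p : E) ^ k • h, fun y => ?_, rfl⟩
  rw [rhoIntegral_eq]
  change (p : E) ^ k • h.1 y ∈ _
  by_cases hy : h.1 y = 0
  · rw [hy, smul_zero]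
    exact zero_mem _
  obtain ⟨b, hb, hm⟩ := hB y hy
  have h1 := (ind_apply_mul_mem_rhoBall_iff hϖ hs h hm b).2 (hδ b)
  rw [inv_mul_cancel_right] at h1
  intro i
  rw [map_smul, Finsupp.smul_apply, smul_eq_mul, norm_mul, norm_pow]
  have h2 : (δ b : ℝ) ≤ ∑ b ∈ B, (δ b : ℝ) :=
    Finset.single_le_sum (f := fun b => (δ b : ℝ)) (fun b _ => (δ b).2) hb
  have h3 : 0 < ∑ b ∈ B, (δ b : ℝ) + 1 := by positivity
  calc ‖(p : E)‖ ^ k * ‖(rhoBasis d).repr (h.1 y) i‖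
      ≤ (∑ b ∈ B, (δ b : ℝ) + 1)⁻¹ * (∑ b ∈ B, (δ b : ℝ) + 1) := by
        gcongr
        exact (h1 i).trans (by linarith)
    _ = ((1 : NNReal) : ℝ) := by rw [inv_mul_cancel₀ h3.ne', NNReal.coe_one]

end Main

end

end BreuilLattice

theorem mainTheorem2
    {p : ℕ} [Fact p.Prime]
    {F : Type*} [NormedField F] [IsUltrametricDist F] [NormedAlgebra ℚ_[p] F]
    [FiniteDimensional ℚ_[p] F]
    {E : Type*} [NormedField E] [IsUltrametricDist E] [NormedAlgebra ℚ_[p] E]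
    [FiniteDimensional ℚ_[p] E]
    (hFE : Nat.card (F →ₐ[ℚ_[p]] E) = Module.finrank ℚ_[p] F)
    (f : ℕ) (hf : Nat.card (IsLocalRing.ResidueField (BreuilLattice.integers F)) = p ^ f)
    (ϖ : BreuilLattice.integers F) (hϖ : BreuilLattice.IsUniformizer ϖ)
    (ι : F →ₐ[ℚ_[p]] E)
    (d : (F →ₐ[ℚ_[p]] E) → ℕ)
    (s : (F →ₐ[ℚ_[p]] E) → E) (hs : BreuilLattice.IsSqrtChoice ϖ d s)
    (hd₁ : ∀ l < f, (BreuilLattice.J f ι d l).ncard ≤ 1)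
    (hd₂ : ∀ l < f, ∀ σ ∈ BreuilLattice.J f ι d l, d σ + 1 ≤ p ^ BreuilLattice.gap f ι d l)
    (a : E) (ha : a ∈ BreuilLattice.integers E) :
    (∀ g : GL (Fin 2) F, ∀ v ∈ BreuilLattice.Theta hϖ hs a,
      BreuilLattice.piRep hϖ hs a g v ∈ BreuilLattice.Theta hϖ hs a) ∧
    BreuilLattice.IsLattice (BreuilLattice.Theta hϖ hs a) ∧
    BreuilLattice.IsSeparated (BreuilLattice.Theta hϖ hs a) ∧
    ¬ BreuilLattice.ContainsLine (BreuilLattice.Theta hϖ hs a) := by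
  have key := fun {c : E} (hc : ‖c‖ < 1) {v : BreuilLattice.PiSpace hϖ hs a} =>
    BreuilLattice.eq_zero_of_forall_mem_smul_Theta hf hϖ hs ι hd₁ hd₂ ha (c := c) hc (v := v)
  refine ⟨fun g v hv => BreuilLattice.piRep_mem_Theta hϖ hs a g hv,
    BreuilLattice.isLattice_Theta hϖ hs a, fun ϖE hϖE => ?_, ?_⟩
  · rw [eq_bot_iff]
    intro v hv
    refine key hϖE.norm_lt_one fun n => ?_
    obtain ⟨w, hw, h⟩ := (Submodule.mem_iInf _).1 hv n
    exact ⟨w, hw, h.symm⟩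
  · rintro ⟨W, hW, hWΘ⟩
    have hbot : W = ⊥ := by
      rw [eq_bot_iff]
      intro v hv
      -- In an `E`-subspace contained in `Θ` every vector is divisible by all powers of `p`.
      refine key (BreuilLattice.norm_natCast_prime_lt_one (p := p) (F := E)) fun n =>
        ⟨((p : E) ^ n)⁻¹ • v, hWΘ _ (W.smul_mem _ hv), ?_⟩
      rw [smul_inv_smul₀ (pow_ne_zero n BreuilLattice.natCast_prime_ne_zero)]
    rw [hbot, finrank_bot] at hW
    exact zero_ne_one hW
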